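/- Let $R$ be a two-sided noetherian (not necessarily commutative) ring. $R$ is called Iwanaga–Gorenstein if ${}_RR$ and $R_R$ have finite injective dimension; it is called Auslander–Gorenstein if moreover, in a minimal injective resolution $0\to {}_RR\to I_0\to I_1\to\cdots$ of the left module ${}_RR$, the flat dimension of $I_i$ is at most $i$ for every $i\ge 0$. For an integer $n\ge 0$ let $\mathcal E_n(R_R)$ be the full subcategory of the category of finitely generated left $R$-modules consisting of those $M$ that are isomorphic to $\mathrm{Ext}^n_R(N,R)$ for some finitely generated right $R$-module $N$, where $\mathrm{Ext}^n_R(N,R)$ is taken over right $R$-modules and is a left $R$-module through left multiplication on $R$. A class of left $R$-modules is submodule-closed if every non-zero submodule of a module in the class is again in the class. **Corollary 3.9.** If $R$ is an Auslander–Gorenstein ring with self-injective dimension $n$ (the injective dimension of ${}_RR$), then $\mathcal E_n(R_R)$ is submodule-closed. Moreover, Auslander's question whether $\mathcal E_1(R_R)$ is submodule-closed has a positive answer for every Auslander–Gorenstein ring $R$. In particular, if $R$ is a commutative Iwanaga–Gorenstein ring, then $\mathcal E_1(R)$ is submodule-closed, and so is $\mathcal E_n(R)$ when $R$ has self-injective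 dimension $n$. -/

import Mathlib

open CategoryTheory
open scoped TensorProduct MulOpposite

universe u

namespace AuslanderGorenstein

section Ext

variable {R S : Type u} [Ring R] [Ring S]
variable (U : Type u) [AddCommGroup U] [Module R U] [Module Sᵐᵒᵖ U] [SMulCommClass R Sᵐᵒᵖ U]

/-- For an `(R, S)`-bimodule `U` and `r : R`, left multiplication by `r` as an endomorphism of the
right `S`-module `U`. Right `S`-modules are modules over `Sᵐᵒᵖ`. -/
def leftMul (r : R) : ModuleCat.of Sᵐᵒᵖ U ⟶ ModuleCat.of Sᵐᵒᵖ U :=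
  ModuleCat.ofHom (DistribSMul.toLinearMap Sᵐᵒᵖ U r)

/-- The action of `R` on `Ext_S^n(N, U)` by functoriality in the second variable: `r` acts through
the right `S`-linear map `x ↦ r • x` of `U`. -/
noncomputable def extAction (N : ModuleCat.{u} Sᵐᵒᵖ) (n : ℕ) :
    R →+* AddMonoid.End (Abelian.Ext.{u} N (ModuleCat.of Sᵐᵒᵖ U) n) where
  toFun r := Abelian.Ext.postcomp (Abelian.Ext.mk₀ (leftMul U r)) N (add_zero n)
  map_one' := by
    have : leftMul (S := S) U (1 : R) = 𝟙 _ := by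
      ext x; exact one_smul R x
    refine AddMonoidHom.ext fun e ↦ ?_
    change Abelian.Ext.comp e (Abelian.Ext.mk₀ _) (add_zero n) = e
    rw [this, Abelian.Ext.comp_mk₀_id]
  map_mul' r s := by
    have : leftMul (S := S) U (r * s) = leftMul U s ≫ leftMul U r := by
      ext x; exact mul_smul r s x
    refine AddMonoidHom.ext fun e ↦ ?_
    change Abelian.Ext.comp e (Abelian.Ext.mk₀ _) (add_zero n) = Abelian.Ext.comp (Abelian.Ext.comp e
      (Abelian.Ext.mk₀ _) (add_zero n)) (Abelian.Ext.mk₀ _) (add_zero n)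
    rw [this, ← Abelian.Ext.mk₀_comp_mk₀, Abelian.Ext.comp_assoc_of_third_deg_zero]
  map_zero' := by
    have : leftMul (S := S) U (0 : R) = 0 := by
      ext x; exact zero_smul R x
    refine AddMonoidHom.ext fun e ↦ ?_
    change Abelian.Ext.comp e (Abelian.Ext.mk₀ _) (add_zero n) = 0
    rw [this, Abelian.Ext.mk₀_zero, Abelian.Ext.comp_zero]
  map_add' r s := by
    have : leftMul (S := S) U (r + s) = leftMul U r + leftMul U s := by
      ext x; exact add_smul r s x
    refine AddMonoidHom.ext fun e ↦ ?_
    change Abelian.Ext.comp e (Abelian.Ext.mk₀ _) (add_zero n) = Abelian.Ext.comp e (Abelian.Ext.mk₀ _) (add_zero n) +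
      Abelian.Ext.comp e (Abelian.Ext.mk₀ _) (add_zero n)
    rw [this, Abelian.Ext.mk₀_add, Abelian.Ext.comp_add]

/-- The group `Ext_S^n(N, U)` of right `S`-modules, for an `(R, S)`-bimodule `U`, with the left
`R`-module structure given by `extAction`. -/
@[nolint unusedArguments]
def BimoduleExt (R : Type u) [Ring R] (U : Type u) [AddCommGroup U] [Module R U] [Module Sᵐᵒᵖ U]
    [SMulCommClass R Sᵐᵒᵖ U] (N : ModuleCat.{u} Sᵐᵒᵖ) (n : ℕ) : Type u :=
  Abelian.Ext.{u} N (ModuleCat.of Sᵐᵒᵖ U) n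

noncomputable instance (N : ModuleCat.{u} Sᵐᵒᵖ) (n : ℕ) : AddCommGroup (BimoduleExt R U N n) :=
  inferInstanceAs (AddCommGroup (Abelian.Ext.{u} N (ModuleCat.of Sᵐᵒᵖ U) n))

noncomputable instance (N : ModuleCat.{u} Sᵐᵒᵖ) (n : ℕ) : Module R (BimoduleExt R U N n) :=
  Module.compHom (Abelian.Ext.{u} N (ModuleCat.of Sᵐᵒᵖ U) n) (extAction U N n)

variable (R S) in
/-- The full subcategory `𝓔_n(U_S)` of `mod R`: the finitely generated left `R`-modules `M` that
are isomorphic to `Ext_S^n(N, U)` for some finitely generated right `S`-module `N`. -/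
def extClass (n : ℕ) : ObjectProperty (ModuleCat.{u} R) :=
  fun M ↦ Module.Finite R M ∧ ∃ N : ModuleCat.{u} Sᵐᵒᵖ, Module.Finite Sᵐᵒᵖ N ∧
    Nonempty (M ≃ₗ[R] BimoduleExt R U N n)

/-- A class of left `R`-modules is submodule-closed if every non-zero submodule of a module in the
class is in the class. -/
def IsSubmoduleClosed (P : ObjectProperty (ModuleCat.{u} R)) : Prop :=
  ∀ M : ModuleCat.{u} R, P M → ∀ A : Submodule R M, A ≠ ⊥ → P (ModuleCat.of R A)

end Ext

section Flat

variable (R : Type u) [Ring R]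

/-- The subgroup of `N ⊗[ℤ] M` generated by the elements `n r ⊗ m - n ⊗ r m`. -/
def balancedRelations (N : Type u) [AddCommGroup N] [Module Rᵐᵒᵖ N]
    (M : Type u) [AddCommGroup M] [Module R M] : AddSubgroup (N ⊗[ℤ] M) :=
  AddSubgroup.closure {x | ∃ (n : N) (r : R) (m : M),
    x = (MulOpposite.op r • n) ⊗ₜ[ℤ] m - n ⊗ₜ[ℤ] (r • m)}

/-- The tensor product `N ⊗_R M` of a right `R`-module `N` and a left `R`-module `M` over a ring
that need not be commutative. -/
abbrev BalancedTensor (N : Type u) [AddCommGroup N] [Module Rᵐᵒᵖ N]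
    (M : Type u) [AddCommGroup M] [Module R M] : Type u :=
  (N ⊗[ℤ] M) ⧸ balancedRelations R N M

/-- The map `f ⊗ M : N ⊗_R M → N' ⊗_R M` induced by a map `f : N → N'` of right `R`-modules. -/
noncomputable def BalancedTensor.map {N N' : Type u} [AddCommGroup N] [Module Rᵐᵒᵖ N]
    [AddCommGroup N'] [Module Rᵐᵒᵖ N'] (f : N →ₗ[Rᵐᵒᵖ] N')
    (M : Type u) [AddCommGroup M] [Module R M] :
    BalancedTensor R N M →+ BalancedTensor R N' M :=
  QuotientAddGroup.map _ _
    (LinearMap.rTensor M f.toAddMonoidHom.toIntLinearMap).toAddMonoidHom <| by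
    rw [balancedRelations, AddSubgroup.closure_le]
    rintro _ ⟨n, r, m, rfl⟩
    refine AddSubgroup.subset_closure ⟨f n, r, m, ?_⟩
    rw [map_sub]
    exact congrArg (fun y ↦ y ⊗ₜ[ℤ] m - f n ⊗ₜ[ℤ] (r • m)) (f.map_smul _ n)

/-- A left `R`-module `M` is flat if `- ⊗_R M` preserves injective maps of right `R`-modules. -/
def IsFlat (M : Type u) [AddCommGroup M] [Module R M] : Prop :=
  ∀ (N N' : Type u) [AddCommGroup N] [Module Rᵐᵒᵖ N] [AddCommGroup N'] [Module Rᵐᵒᵖ N']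
    (f : N →ₗ[Rᵐᵒᵖ] N'), Function.Injective f → Function.Injective (BalancedTensor.map R f M)

/-- `FlatDimLE R n M`: the flat dimension of the left `R`-module `M` is at most `n`, that is, there
is an exact sequence `0 → F_n → ⋯ → F_1 → F_0 → M → 0` with all `F_i` flat. The sequence is cut
into `0 → K → F_0 → M → 0` and a flat resolution of length `n - 1` of the kernel `K`. -/
def FlatDimLE : ℕ → ∀ (M : Type u) [AddCommGroup M] [Module R M], Prop
  | 0, M, _, _ => IsFlat R M
  | n + 1, M, _, _ => ∃ (F : ModuleCat.{u} R) (p : F →ₗ[R] M),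
      IsFlat R F ∧ Function.Surjective p ∧ FlatDimLE n (LinearMap.ker p)

end Flat

section Gorenstein

/-- An injective resolution `0 → Z → I_0 → I_1 → ⋯` is minimal if the kernel of `I_i → I_{i+1}`
(the image of the preceding map) is an essential submodule of `I_i` for every `i ≥ 0`. -/
def IsMinimalResolution {R : Type u} [Ring R] {Z : ModuleCat.{u} R}
    (I : InjectiveResolution Z) : Prop :=
  ∀ (i : ℕ) (L : Submodule R (I.cocomplex.X i)), L ≠ ⊥ →
    L ⊓ LinearMap.ker (I.cocomplex.d i (i + 1)).hom ≠ ⊥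

variable (R : Type u) [Ring R]

/-- The injective dimension of `R` as a left module over itself. -/
noncomputable def leftSelfInjDim : WithBot ℕ∞ :=
  injectiveDimension (ModuleCat.of R R)

/-- The injective dimension of `R` as a right module over itself. -/
noncomputable def rightSelfInjDim : WithBot ℕ∞ :=
  injectiveDimension (ModuleCat.of Rᵐᵒᵖ R)

/-- Iwanaga–Gorenstein rings: two-sided noetherian rings of finite injective dimension as left and
as right modules over themselves. -/
structure IsIwanagaGorenstein : Prop where
  left_noetherian : IsNoetherianRing R
  right_noetherian : IsNoetherianRing Rᵐᵒᵖ
  left_finite : leftSelfInjDim R < ⊤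
  right_finite : rightSelfInjDim R < ⊤

/-- The Auslander condition: in a minimal injective resolution `0 → R → I_0 → I_1 → ⋯` of the left
module `R`, the flat dimension of `I_i` is at most `i` for every `i ≥ 0`. A minimal injective
resolution exists and is unique up to isomorphism, so it does not matter which one is taken. -/
def AuslanderCondition : Prop :=
  ∃ I : InjectiveResolution (ModuleCat.of R R), IsMinimalResolution I ∧
    ∀ i : ℕ, FlatDimLE R i (I.cocomplex.X i)

/-- Auslander–Gorenstein rings. -/
structure IsAuslanderGorenstein : Prop extends IsIwanagaGorenstein R where
  auslander : AuslanderCondition R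

end Gorenstein

end AuslanderGorenstein

/-! Write `A` for the ring. Two facts combine. (a) If `M` is finitely generated and `Ext^j(M, A) =
0` for `j ≤ n`, then `M ≅ Ext^{n+1}(N, A)` for some finitely generated `N`. Indeed, for the
transpose `T` of a presentation of `M`, `M* = 0` gives `Ext^1(T, A) ≅ M`, and vanishing in degrees
`1, …, n` keeps the dualized resolution exact, so that `T` is an `n`-th syzygy of some `N`
(`extClass_of_ext_eq_zero`). (b) Every submodule `X` of `Ext^{n+1}(N, A)` satisfies `Ext^j(X, A) =
0` for `j ≤ n`. So it remains to prove (b).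

Auslander case: for `I` injective, `Hom(Ext^{n+1}(N, A), I)` is `Tor_{n+1}(N, I)`, which is zero if
`I` has flat dimension at most `n` (`hom_bimoduleExt_eq_zero`). A map `X → I_j` extends to
`Ext^{n+1}(N, A) → I_j`, hence is zero, and classes in `Ext^j(X, A)` are represented by such maps.

Commutative case: (b) is proved by supports, without the Auslander condition. In the top degree `n`,
a prime in the support of `Ext^n(N, A)` is a maximal ideal `p` with `Ext^n(A/p, A) ≠ 0`; Rees'
induction gives `Ext^j(A/p, A) = 0` for `j < n`, and a prime filtration of `X` concludes
(`subsingleton_ext_of_injective_top`). In degree 1, `Ext^1(N, A)` vanishes at the associated primes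
of `A`, so `Hom(X, A) = 0` (`subsingleton_ext_of_injective_one`).

Degree 0 lies outside (a): for self-injective `A`, finitely generated left modules are reflexive,
hence duals. -/

namespace AuslanderGorenstein

/-! ### Short exact sequences of modules -/

section Sequences

variable {A : Type u} [Ring A] {K F N : Type u} [AddCommGroup K] [Module A K]
  [AddCommGroup F] [Module A F] [AddCommGroup N] [Module A N]
  {f : K →ₗ[A] F} {g : F →ₗ[A] N}

/-- The short complex in `ModuleCat A` of an exact pair of linear maps. -/
abbrev exactComplex (hfg : Function.Exact f g) : ShortComplex (ModuleCat.{u} A) :=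
  ShortComplex.mk (ModuleCat.ofHom f) (ModuleCat.ofHom g) <| by
    ext x; exact hfg.apply_apply_eq_zero x

lemma shortExact_exactComplex (hf : Function.Injective f) (hfg : Function.Exact f g)
    (hg : Function.Surjective g) : (exactComplex hfg).ShortExact :=
  ModuleCat.shortComplex_shortExact _ hfg hf hg

end Sequences

/-! ### Linear dimension shifting and connecting maps for `Ext` into a bimodule -/

section BimoduleExt

variable {R S : Type u} [Ring R] [Ring S]
variable {U : Type u} [AddCommGroup U] [Module R U] [Module Sᵐᵒᵖ U] [SMulCommClass R Sᵐᵒᵖ U]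

variable (U) in
/-- Composition with a fixed extension class in the first variable is `R`-linear. -/
noncomputable def BimoduleExt.precomp {N N' : ModuleCat.{u} Sᵐᵒᵖ} {a b c : ℕ}
    (e : Abelian.Ext.{u} N N' a) (h : a + b = c) :
    BimoduleExt R U N' b →ₗ[R] BimoduleExt R U N c where
  toFun x := e.comp (Z := ModuleCat.of Sᵐᵒᵖ U) x h
  map_add' x y := Abelian.Ext.comp_add e x y h
  map_smul' r x :=
    (Abelian.Ext.comp_assoc_of_third_deg_zero (Z := ModuleCat.of Sᵐᵒᵖ U)
      (T := ModuleCat.of Sᵐᵒᵖ U) e x (Abelian.Ext.mk₀ (leftMul U r)) h).symm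

variable {K F N : Type u} [AddCommGroup K] [Module Sᵐᵒᵖ K]
  [AddCommGroup F] [Module Sᵐᵒᵖ F] [AddCommGroup N] [Module Sᵐᵒᵖ N]
  {f : K →ₗ[Sᵐᵒᵖ] F} {g : F →ₗ[Sᵐᵒᵖ] N}

variable (R U) in
/-- Dimension shifting along `0 → K → F → N → 0` with `F` projective. -/
lemma BimoduleExt.nonempty_shift [Module.Projective Sᵐᵒᵖ F] (hf : Function.Injective f)
    (hfg : Function.Exact f g) (hg : Function.Surjective g) (n : ℕ) :
    Nonempty (BimoduleExt R U (ModuleCat.of Sᵐᵒᵖ K) (n + 1) ≃ₗ[R]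
      BimoduleExt R U (ModuleCat.of Sᵐᵒᵖ N) (n + 1 + 1)) := by
  have hS := shortExact_exactComplex hf hfg hg
  refine ⟨LinearEquiv.ofBijective (BimoduleExt.precomp U hS.extClass (add_comm 1 (n + 1))) ⟨?_, ?_⟩⟩
  · rw [injective_iff_map_eq_zero]
    intro x hx
    obtain ⟨y, rfl⟩ := Abelian.Ext.contravariant_sequence_exact₁ hS (ModuleCat.of Sᵐᵒᵖ U) x
      (add_comm 1 (n + 1)) hx
    have : y = 0 := Abelian.Ext.eq_zero_of_projective (P := ModuleCat.of Sᵐᵒᵖ F) y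
    rw [this]
    exact map_zero (BimoduleExt.precomp (R := R) U (Abelian.Ext.mk₀ (exactComplex hfg).f)
      (zero_add (n + 1)))
  · intro x
    exact Abelian.Ext.contravariant_sequence_exact₃ hS (ModuleCat.of Sᵐᵒᵖ U) x
      (Abelian.Ext.eq_zero_of_projective (P := ModuleCat.of Sᵐᵒᵖ F) _) (add_comm 1 (n + 1))

variable [SMulCommClass Sᵐᵒᵖ R U]

variable (U) in
/-- `Ext^0` is the module of homomorphisms. -/
noncomputable def BimoduleExt.homEquiv (N : Type u) [AddCommGroup N] [Module Sᵐᵒᵖ N] :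
    (N →ₗ[Sᵐᵒᵖ] U) ≃ₗ[R] BimoduleExt R U (ModuleCat.of Sᵐᵒᵖ N) 0 where
  __ := ((ModuleCat.homAddEquiv (M := ModuleCat.of Sᵐᵒᵖ N) (N := ModuleCat.of Sᵐᵒᵖ U)).symm.trans
    (Abelian.Ext.addEquiv₀ (X := ModuleCat.of Sᵐᵒᵖ N) (Y := ModuleCat.of Sᵐᵒᵖ U)).symm :)
  map_smul' r φ := by
    change Abelian.Ext.mk₀ (ModuleCat.ofHom (r • φ)) =
      Abelian.Ext.comp (Abelian.Ext.mk₀ (ModuleCat.ofHom φ)) (Abelian.Ext.mk₀ (leftMul U r))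
        (add_zero 0)
    rw [Abelian.Ext.mk₀_comp_mk₀]
    rfl

variable (R U) in
/-- The presentation of `Ext^1(N, U)` as the cokernel of `Hom(F, U) → Hom(K, U)`, for
`0 → K → F → N → 0` with `F` projective. -/
lemma BimoduleExt.exists_connecting [Module.Projective Sᵐᵒᵖ F] (hf : Function.Injective f)
    (hfg : Function.Exact f g) (hg : Function.Surjective g) :
    ∃ δ : (K →ₗ[Sᵐᵒᵖ] U) →ₗ[R] BimoduleExt R U (ModuleCat.of Sᵐᵒᵖ N) 1,
      Function.Surjective δ ∧ ∀ φ, δ φ = 0 ↔ ∃ ψ : F →ₗ[Sᵐᵒᵖ] U, ψ ∘ₗ f = φ := by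
  have hS := shortExact_exactComplex hf hfg hg
  refine ⟨BimoduleExt.precomp U hS.extClass (add_comm 1 0) ∘ₗ
    (BimoduleExt.homEquiv U K).toLinearMap, ?_, fun φ ↦ ⟨fun h ↦ ?_, ?_⟩⟩
  · intro x
    obtain ⟨y, hy⟩ := Abelian.Ext.contravariant_sequence_exact₃ hS (ModuleCat.of Sᵐᵒᵖ U) x
      (Abelian.Ext.eq_zero_of_projective (P := ModuleCat.of Sᵐᵒᵖ F) _) (add_comm 1 0)
    obtain ⟨φ, rfl⟩ := (BimoduleExt.homEquiv (R := R) U K).surjective y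
    exact ⟨φ, hy⟩
  · obtain ⟨y, hy⟩ := Abelian.Ext.contravariant_sequence_exact₁ hS (ModuleCat.of Sᵐᵒᵖ U) _
      (add_comm 1 0) h
    obtain ⟨ψ, rfl⟩ := (BimoduleExt.homEquiv (R := R) U F).surjective y
    refine ⟨ψ, (BimoduleExt.homEquiv (R := R) U K).injective ?_⟩
    refine Eq.trans ?_ hy
    exact (Abelian.Ext.mk₀_comp_mk₀ (ModuleCat.ofHom f) (ModuleCat.ofHom ψ)).symm
  · rintro ⟨ψ, rfl⟩
    change Abelian.Ext.comp _ (Abelian.Ext.mk₀ (ModuleCat.ofHom f ≫ ModuleCat.ofHom ψ))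
      (add_comm 1 0) = 0
    rw [← Abelian.Ext.mk₀_comp_mk₀]
    exact hS.extClass_comp_assoc _

end BimoduleExt

/-! ### Vanishing of `Ext` along short exact sequences -/

section LeftExt

lemma ext_inv_comp_hom_comp {C : Type*} [Category C] [Abelian C] [HasExt C] {X X' Y : C}
    (e : X ≅ X') {n : ℕ} (x : Abelian.Ext X' Y n) :
    (Abelian.Ext.mk₀ e.inv).comp ((Abelian.Ext.mk₀ e.hom).comp x (zero_add n)) (zero_add n) = x := by
  rw [Abelian.Ext.mk₀_comp_mk₀_assoc, e.inv_hom_id, Abelian.Ext.mk₀_id_comp]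

variable {A : Type u} [Ring A] {K F N : Type u} [AddCommGroup K] [Module A K]
  [AddCommGroup F] [Module A F] [AddCommGroup N] [Module A N]
  {f : K →ₗ[A] F} {g : F →ₗ[A] N}

/-- Homomorphisms extend along an injection whose cokernel has vanishing `Ext^1`. -/
lemma exists_extend_of_ext_one (hf : Function.Injective f) (hfg : Function.Exact f g)
    (hg : Function.Surjective g) {Y : ModuleCat.{u} A}
    (h : Subsingleton (Abelian.Ext.{u} (ModuleCat.of A N) Y 1)) (φ : K →ₗ[A] Y) :
    ∃ ψ : F →ₗ[A] Y, ψ ∘ₗ f = φ := by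
  have hS := shortExact_exactComplex hf hfg hg
  obtain ⟨y, hy⟩ := Abelian.Ext.contravariant_sequence_exact₁ hS Y
    (Abelian.Ext.mk₀ (ModuleCat.ofHom φ)) (add_comm 1 0) (Subsingleton.elim _ _)
  obtain ⟨ψ, rfl⟩ := Abelian.Ext.mk₀_bijective _ _ |>.surjective y
  rw [Abelian.Ext.mk₀_comp_mk₀] at hy
  have := (Abelian.Ext.mk₀_bijective _ _).injective hy
  exact ⟨ψ.hom, congrArg ModuleCat.Hom.hom this⟩

lemma subsingleton_ext_of_exact_left (hf : Function.Injective f) (hfg : Function.Exact f g)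
    (hg : Function.Surjective g) {Y : ModuleCat.{u} A} (n : ℕ)
    (hF : Subsingleton (Abelian.Ext.{u} (ModuleCat.of A F) Y n))
    (hN : Subsingleton (Abelian.Ext.{u} (ModuleCat.of A N) Y (n + 1))) :
    Subsingleton (Abelian.Ext.{u} (ModuleCat.of A K) Y n) := by
  have hS := shortExact_exactComplex hf hfg hg
  refine subsingleton_of_forall_eq 0 fun x ↦ ?_
  obtain ⟨y, rfl⟩ := Abelian.Ext.contravariant_sequence_exact₁ hS Y x (add_comm 1 n)
    (Subsingleton.elim _ _)
  rw [Subsingleton.elim y 0, Abelian.Ext.comp_zero]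

lemma subsingleton_ext_of_exact_middle (hf : Function.Injective f) (hfg : Function.Exact f g)
    (hg : Function.Surjective g) {Y : ModuleCat.{u} A} (n : ℕ)
    (hK : Subsingleton (Abelian.Ext.{u} (ModuleCat.of A K) Y n))
    (hN : Subsingleton (Abelian.Ext.{u} (ModuleCat.of A N) Y n)) :
    Subsingleton (Abelian.Ext.{u} (ModuleCat.of A F) Y n) := by
  have hS := shortExact_exactComplex hf hfg hg
  refine subsingleton_of_forall_eq 0 fun x ↦ ?_
  obtain ⟨y, rfl⟩ := Abelian.Ext.contravariant_sequence_exact₂ hS Y x (Subsingleton.elim _ _)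
  rw [Subsingleton.elim y 0, Abelian.Ext.comp_zero]

lemma subsingleton_ext_of_exact_right (hf : Function.Injective f) (hfg : Function.Exact f g)
    (hg : Function.Surjective g) {Y : ModuleCat.{u} A} (n : ℕ)
    (hK : Subsingleton (Abelian.Ext.{u} (ModuleCat.of A K) Y n))
    (hF : Subsingleton (Abelian.Ext.{u} (ModuleCat.of A F) Y (n + 1))) :
    Subsingleton (Abelian.Ext.{u} (ModuleCat.of A N) Y (n + 1)) := by
  have hS := shortExact_exactComplex hf hfg hg
  refine subsingleton_of_forall_eq 0 fun x ↦ ?_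
  obtain ⟨y, rfl⟩ := Abelian.Ext.contravariant_sequence_exact₃ hS Y x (Subsingleton.elim _ _)
    (add_comm 1 n)
  rw [Subsingleton.elim y 0, Abelian.Ext.comp_zero]

lemma subsingleton_ext_congr {M M' : Type u} [AddCommGroup M] [Module A M] [AddCommGroup M']
    [Module A M'] (e : M ≃ₗ[A] M') {Y : ModuleCat.{u} A} {n : ℕ}
    (h : Subsingleton (Abelian.Ext.{u} (ModuleCat.of A M) Y n)) :
    Subsingleton (Abelian.Ext.{u} (ModuleCat.of A M') Y n) := by
  refine subsingleton_of_forall_eq 0 fun x ↦ ?_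
  rw [← ext_inv_comp_hom_comp e.toModuleIso x,
    Subsingleton.elim ((Abelian.Ext.mk₀ e.toModuleIso.hom).comp x (zero_add n)) 0,
    Abelian.Ext.comp_zero]

end LeftExt

/-! ### Duals, transposes and modules of the form `Ext^{n+1}(N, A)` -/

section Dual

variable {A : Type u} [Ring A] {P Q L : Type u} [AddCommGroup P] [Module A P]
  [AddCommGroup Q] [Module A Q] [AddCommGroup L] [Module A L]

/-- The transpose `Hom(Q, A) → Hom(P, A)` of `g : P → Q`, as a map of right `A`-modules. -/
def dualMap (g : P →ₗ[A] Q) : (Q →ₗ[A] A) →ₗ[Aᵐᵒᵖ] (P →ₗ[A] A) where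
  toFun φ := φ ∘ₗ g
  map_add' _ _ := rfl
  map_smul' _ _ := rfl

@[simp]
lemma dualMap_apply (g : P →ₗ[A] Q) (φ : Q →ₗ[A] A) : dualMap g φ = φ ∘ₗ g := rfl

variable (A P) in
/-- The evaluation map from a left module to its double dual. -/
def evalDual : P →ₗ[A] ((P →ₗ[A] A) →ₗ[Aᵐᵒᵖ] A) where
  toFun p :=
    { toFun φ := φ p
      map_add' _ _ := rfl
      map_smul' _ _ := rfl }
  map_add' p q := by ext φ; exact map_add φ p q
  map_smul' r p := by ext φ; exact map_smul φ r p

@[simp]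
lemma evalDual_apply (p : P) (φ : P →ₗ[A] A) : evalDual A P p φ = φ p := rfl

/-- The coordinate projections generate the dual as a right module, so a functional on the dual is
evaluation at the vector of its values on them. This reflexivity is what lets maps between duals be
undone. -/
lemma evalDual_pi_bijective (n : ℕ) : Function.Bijective (evalDual A (Fin n → A)) := by
  constructor
  · intro p q h
    ext i
    exact LinearMap.congr_fun h (LinearMap.proj i)
  · intro φ
    refine ⟨fun i ↦ φ (LinearMap.proj i), LinearMap.ext fun f ↦ ?_⟩
    have hf : f = ∑ i, MulOpposite.op (f (Pi.single i 1)) • LinearMap.proj i := by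
      refine LinearMap.pi_ext' fun j ↦ LinearMap.ext_ring ?_
      simp [Pi.single_apply]
    rw [evalDual_apply]
    conv_rhs => rw [hf, map_sum]
    conv_lhs => rw [LinearMap.pi_apply_eq_sum_univ f]
    refine Finset.sum_congr rfl fun i _ ↦ ?_
    rw [map_smul, smul_eq_mul, MulOpposite.smul_eq_mul_unop, MulOpposite.unop_op]
    congr 2
    ext j
    simp [Pi.single_apply, eq_comm]

variable (A) in
/-- A ring as a right module over itself is the left regular module of the opposite ring. -/
def opRegularEquiv : Aᵐᵒᵖ ≃ₗ[Aᵐᵒᵖ] A where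
  toFun := MulOpposite.unop
  invFun := MulOpposite.op
  map_add' _ _ := rfl
  map_smul' _ _ := rfl
  left_inv _ := rfl
  right_inv _ := rfl

variable (A) in
/-- The right module of row vectors is free. -/
def opPiEquiv (n : ℕ) : (Fin n → Aᵐᵒᵖ) ≃ₗ[Aᵐᵒᵖ] (Fin n → A) :=
  LinearEquiv.piCongrRight fun _ ↦ opRegularEquiv A

instance (n : ℕ) : Module.Projective Aᵐᵒᵖ (Fin n → A) :=
  Module.Projective.of_equiv (opPiEquiv A n)

instance (n : ℕ) : Module.Finite Aᵐᵒᵖ (Fin n → A) :=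
  Module.Finite.equiv (opPiEquiv A n)

instance (n : ℕ) : Module.Projective Aᵐᵒᵖ ((Fin n → A) →ₗ[A] A) :=
  Module.Projective.of_equiv (LinearEquiv.piRing A A (Fin n) Aᵐᵒᵖ).symm

instance (n : ℕ) : Module.Finite Aᵐᵒᵖ ((Fin n → A) →ₗ[A] A) :=
  Module.Finite.equiv (LinearEquiv.piRing A A (Fin n) Aᵐᵒᵖ).symm

/-- The cokernel of the transpose of `g : P → Q`. -/
abbrev Transpose (g : P →ₗ[A] Q) : Type u := (P →ₗ[A] A) ⧸ LinearMap.range (dualMap g)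

/-- A homomorphism vanishing on `ker g` factors through `g` if `Ext^1(coker g, Y) = 0`. -/
lemma exists_factor_of_ext_one (g : P →ₗ[A] Q) {Y : ModuleCat.{u} A}
    (h : Subsingleton (Abelian.Ext.{u} (ModuleCat.of A (Q ⧸ LinearMap.range g)) Y 1))
    (φ : P →ₗ[A] Y) (hk : LinearMap.ker g ≤ LinearMap.ker φ) : ∃ ψ : Q →ₗ[A] Y, ψ ∘ₗ g = φ := by
  obtain ⟨ψ, hψ⟩ := exists_extend_of_ext_one (LinearMap.range g).injective_subtype
    (LinearMap.exact_subtype_mkQ _) (Submodule.mkQ_surjective _) h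
    ((LinearMap.ker g).liftQ φ hk ∘ₗ g.quotKerEquivRange.symm.toLinearMap)
  refine ⟨ψ, LinearMap.ext fun x ↦ (LinearMap.congr_fun hψ (g.rangeRestrict x)).trans ?_⟩
  change (LinearMap.ker g).liftQ φ hk (g.quotKerEquivRange.symm ⟨g x, _⟩) = _
  rw [LinearMap.quotKerEquivRange_symm_apply_image]
  rfl

/-- If `Ext^1(coker g, A) = 0`, then dualizing `L → P → Q` preserves exactness at `P`. -/
lemma exact_dualMap {g' : L →ₗ[A] P} {g : P →ₗ[A] Q} (hg : Function.Exact g' g)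
    (h : Subsingleton (Abelian.Ext.{u} (ModuleCat.of A (Q ⧸ LinearMap.range g))
      (ModuleCat.of A A) 1)) : Function.Exact (dualMap g) (dualMap g') := by
  intro φ
  constructor
  · intro hφ
    refine exists_factor_of_ext_one g h φ fun x hx ↦ ?_
    obtain ⟨y, rfl⟩ := (hg x).1 hx
    exact LinearMap.congr_fun hφ y
  · rintro ⟨ψ, rfl⟩
    refine LinearMap.ext fun x ↦ ?_
    change ψ (g (g' x)) = 0
    rw [hg.apply_apply_eq_zero, map_zero]

/-- Every finitely generated submodule is the range of a map from a finite free module. -/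
lemma exists_range_eq [IsNoetherianRing A] {n : ℕ} (K : Submodule A (Fin n → A)) :
    ∃ (m : ℕ) (g : (Fin m → A) →ₗ[A] (Fin n → A)), LinearMap.range g = K := by
  obtain ⟨m, f, hf⟩ := Module.Finite.exists_fin' A K
  exact ⟨m, K.subtype ∘ₗ f, by rw [LinearMap.range_comp, LinearMap.range_eq_top.2 hf]; simp⟩

/-- Every map from a finite free module can be continued to the left to an exact sequence. -/
lemma exists_exact [IsNoetherianRing A] {n : ℕ} (f : (Fin n → A) →ₗ[A] P) :
    ∃ (m : ℕ) (g : (Fin m → A) →ₗ[A] (Fin n → A)), Function.Exact g f := by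
  obtain ⟨m, g, hg⟩ := exists_range_eq (LinearMap.ker f)
  exact ⟨m, g, LinearMap.exact_iff.2 hg.symm⟩

/-- If the dual of `L → P → Q` is exact, then the cokernel of the transpose of `P → Q` embeds in the
dual of `L`. -/
lemma exists_transpose_embedding {g' : L →ₗ[A] P} {g : P →ₗ[A] Q}
    (hd : Function.Exact (dualMap g) (dualMap g')) :
    ∃ j : Transpose g →ₗ[Aᵐᵒᵖ] (L →ₗ[A] A), Function.Injective j ∧
      j ∘ₗ (LinearMap.range (dualMap g)).mkQ = dualMap g' ∧
      Function.Exact j (LinearMap.range (dualMap g')).mkQ := by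
  refine ⟨(LinearMap.range (dualMap g)).liftQ (dualMap g') ?_, ?_, ?_, ?_⟩
  · exact (LinearMap.exact_iff.1 hd).ge
  · rw [← LinearMap.ker_eq_bot, Submodule.ker_liftQ_eq_bot']
    exact (LinearMap.exact_iff.1 hd).symm
  · exact Submodule.liftQ_mkQ _ _ _
  · rw [LinearMap.exact_iff, Submodule.ker_mkQ, Submodule.range_liftQ]

/-- By exactness `P / range g' ≅ range g`, which is a first syzygy of `coker g` because `Q` is
projective. -/
lemma ext_quotient_range_shift {g' : L →ₗ[A] P} {g : P →ₗ[A] Q} (hg : Function.Exact g' g)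
    [Module.Projective A Q] (i : ℕ)
    (h : Subsingleton (Abelian.Ext.{u} (ModuleCat.of A (Q ⧸ LinearMap.range g))
      (ModuleCat.of A A) (i + 2))) :
    Subsingleton (Abelian.Ext.{u} (ModuleCat.of A (P ⧸ LinearMap.range g'))
      (ModuleCat.of A A) (i + 1)) := by
  have e : (P ⧸ LinearMap.range g') ≃ₗ[A] LinearMap.range g :=
    (Submodule.quotEquivOfEq _ _ (LinearMap.exact_iff.1 hg).symm).trans g.quotKerEquivRange
  exact subsingleton_ext_congr e.symm (subsingleton_ext_of_exact_left
    (LinearMap.range g).injective_subtype (LinearMap.exact_subtype_mkQ _)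
    (Submodule.mkQ_surjective _) (i + 1)
    (Abelian.Ext.subsingleton_of_projective (P := ModuleCat.of A Q) _ _) h)

/-- If `Ext^i(coker g, A) = 0` for `1 ≤ i ≤ k`, then the transpose of `g` is, up to projectives, a
`k`-th syzygy of a finitely generated right module. -/
lemma exists_bimoduleExt_transpose_equiv [IsNoetherianRing A] (k : ℕ) :
    ∀ {a b : ℕ} (g : (Fin a → A) →ₗ[A] (Fin b → A)),
      (∀ i, i < k → Subsingleton (Abelian.Ext.{u}
        (ModuleCat.of A ((Fin b → A) ⧸ LinearMap.range g)) (ModuleCat.of A A) (i + 1))) →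
      ∃ N : ModuleCat.{u} Aᵐᵒᵖ, Module.Finite Aᵐᵒᵖ N ∧ ∀ m, Nonempty
        (BimoduleExt A A (ModuleCat.of Aᵐᵒᵖ (Transpose g)) (m + 1) ≃ₗ[A]
          BimoduleExt A A N (m + k + 1)) := by
  induction k with
  | zero => exact fun g _ ↦ ⟨ModuleCat.of Aᵐᵒᵖ (Transpose g), inferInstanceAs
      (Module.Finite Aᵐᵒᵖ (Transpose g)), fun m ↦ ⟨LinearEquiv.refl _ _⟩⟩
  | succ k ih =>
    intro a b g h
    obtain ⟨c, g', hg⟩ := exists_exact g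
    -- Exactness of the dual gives `0 → Tr g → L* → Tr g' → 0` with `L*` free, so `Tr g` is a syzygy
    -- of `Tr g'`. On the other side `coker g'` is a syzygy of `coker g`, so `g'` inherits one
    -- vanishing degree less.
    obtain ⟨j, hj, -, hjr⟩ := exists_transpose_embedding (exact_dualMap hg (h 0 k.succ_pos))
    obtain ⟨N, hN, e⟩ := ih g' fun i hi ↦
      ext_quotient_range_shift hg i (h (i + 1) (Nat.succ_lt_succ hi))
    refine ⟨N, hN, fun m ↦ ?_⟩
    obtain ⟨e₁⟩ := BimoduleExt.nonempty_shift A A hj hjr (Submodule.mkQ_surjective _) m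
    obtain ⟨e₂⟩ := e (m + 1)
    rw [show m + (k + 1) + 1 = m + 1 + k + 1 by ring]
    exact ⟨e₁.trans e₂⟩

/-- Every map between duals of finite free left modules is a transpose. -/
lemma exists_dualMap_eq {a b : ℕ}
    (h : ((Fin a → A) →ₗ[A] A) →ₗ[Aᵐᵒᵖ] ((Fin b → A) →ₗ[A] A)) :
    ∃ g : (Fin b → A) →ₗ[A] (Fin a → A), dualMap g = h := by
  let e := LinearEquiv.ofBijective _ (evalDual_pi_bijective (A := A) a)
  let h' : ((((Fin b → A) →ₗ[A] A) →ₗ[Aᵐᵒᵖ] A)) →ₗ[A] (((Fin a → A) →ₗ[A] A) →ₗ[Aᵐᵒᵖ] A) :=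
    { toFun χ := χ ∘ₗ h
      map_add' _ _ := rfl
      map_smul' _ _ := rfl }
  -- The transpose of `h`, with finite free modules identified with their double duals.
  refine ⟨e.symm.toLinearMap ∘ₗ h' ∘ₗ evalDual A (Fin b → A), ?_⟩
  ext1 φ
  refine LinearMap.ext fun x ↦ ?_
  exact LinearMap.congr_fun (e.apply_symm_apply (h' (evalDual A _ x))) φ

/-- Over a right noetherian ring, every submodule of the dual of a finite free left module is the
range of a transpose. -/
lemma exists_range_dualMap_eq [IsNoetherianRing Aᵐᵒᵖ] {b : ℕ}
    (K : Submodule Aᵐᵒᵖ ((Fin b → A) →ₗ[A] A)) :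
    ∃ (a : ℕ) (g : (Fin b → A) →ₗ[A] (Fin a → A)), LinearMap.range (dualMap g) = K := by
  obtain ⟨a, f, hf⟩ := Module.Finite.exists_fin' Aᵐᵒᵖ K
  let e := (LinearEquiv.piRing A A (Fin a) Aᵐᵒᵖ).trans (opPiEquiv A a).symm
  obtain ⟨g, hg⟩ := exists_dualMap_eq (K.subtype ∘ₗ f ∘ₗ e.toLinearMap)
  refine ⟨a, g, ?_⟩
  rw [hg, LinearMap.range_comp, LinearMap.range_comp_of_range_eq_top f e.range,
    LinearMap.range_eq_top.2 hf]
  simp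

/-- Every finitely generated right module over a right noetherian ring is a transpose. -/
lemma exists_transpose_equiv [IsNoetherianRing Aᵐᵒᵖ] (T : Type u) [AddCommGroup T] [Module Aᵐᵒᵖ T]
    [Module.Finite Aᵐᵒᵖ T] :
    ∃ (b a : ℕ) (g : (Fin b → A) →ₗ[A] (Fin a → A)), Nonempty (Transpose g ≃ₗ[Aᵐᵒᵖ] T) := by
  obtain ⟨b, f, hf⟩ := Module.Finite.exists_fin' Aᵐᵒᵖ T
  let e := (LinearEquiv.piRing A A (Fin b) Aᵐᵒᵖ).trans (opPiEquiv A b).symm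
  obtain ⟨a, g, hg⟩ := exists_range_dualMap_eq (LinearMap.ker (f ∘ₗ e.toLinearMap))
  exact ⟨b, a, g, ⟨(Submodule.quotEquivOfEq _ _ hg).trans
    ((f ∘ₗ e.toLinearMap).quotKerEquivOfSurjective (hf.comp e.surjective))⟩⟩

/-- If `g` has an injective transpose, its cokernel is `Ext^1` of the transpose. -/
lemma nonempty_quotient_range_equiv {a b : ℕ} (g : (Fin a → A) →ₗ[A] (Fin b → A))
    (hg : Function.Injective (dualMap g)) :
    Nonempty (((Fin b → A) ⧸ LinearMap.range g) ≃ₗ[A]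
      BimoduleExt A A (ModuleCat.of Aᵐᵒᵖ (Transpose g)) 1) := by
  -- With `P` and `Q` the source and target of `g`, the sequence `0 → Q* → P* → Tr g → 0` is a
  -- projective resolution; hence `Ext^1(Tr g, A)` is the cokernel of `P** → Q**`, which by
  -- reflexivity is that of `g`.
  obtain ⟨δ, hδ, hk⟩ := BimoduleExt.exists_connecting A A hg
    (LinearMap.exact_map_mkQ_range _) (Submodule.mkQ_surjective _)
  let e := LinearEquiv.ofBijective _ (evalDual_pi_bijective (A := A) b)
  have hs : Function.Surjective (δ ∘ₗ e.toLinearMap) := hδ.comp e.surjective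
  refine ⟨(Submodule.quotEquivOfEq _ _ ?_).trans ((δ ∘ₗ e.toLinearMap).quotKerEquivOfSurjective hs)⟩
  ext p
  rw [LinearMap.mem_ker]
  refine Iff.trans ?_ (hk _).symm
  constructor
  · rintro ⟨q, rfl⟩
    exact ⟨evalDual A _ q, rfl⟩
  · rintro ⟨ψ, hψ⟩
    obtain ⟨q, rfl⟩ := (evalDual_pi_bijective a).surjective ψ
    refine ⟨q, (evalDual_pi_bijective b).injective ?_⟩
    exact hψ

/-- Over a left noetherian ring, a finitely generated left module `M` with `Ext^j(M, A) = 0` for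
all `j ≤ n` is of the form `Ext^{n+1}(N, A)`. -/
theorem extClass_of_ext_eq_zero [IsNoetherianRing A] (n : ℕ) (M : ModuleCat.{u} A)
    [Module.Finite A M] (h : ∀ j, j < n + 1 → Subsingleton (Abelian.Ext.{u} M (ModuleCat.of A A) j)) :
    extClass A A A (n + 1) M := by
  refine ⟨inferInstance, ?_⟩
  obtain ⟨b, p, hp⟩ := Module.Finite.exists_fin' A M
  obtain ⟨a, g, hg⟩ := exists_exact p
  let e : ((Fin b → A) ⧸ LinearMap.range g) ≃ₗ[A] M :=
    (Submodule.quotEquivOfEq _ _ (LinearMap.exact_iff.1 hg).symm).trans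
      (p.quotKerEquivOfSurjective hp)
  -- The kernel of the transpose of `g` is `Hom(M, A)`, which is zero by the case `j = 0`.
  have hinj : Function.Injective (dualMap g) := by
    rw [injective_iff_map_eq_zero]
    intro φ hφ
    have hk : LinearMap.range g ≤ LinearMap.ker φ := by
      rintro _ ⟨x, rfl⟩
      exact LinearMap.congr_fun hφ x
    have h0 : (LinearMap.range g).liftQ φ hk ∘ₗ e.symm.toLinearMap = 0 := by
      have := h 0 n.succ_pos
      exact congrArg ModuleCat.Hom.hom ((Abelian.Ext.mk₀_bijective M (ModuleCat.of A A)).injective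
        (Subsingleton.elim (Abelian.Ext.mk₀ (ModuleCat.ofHom
          ((LinearMap.range g).liftQ φ hk ∘ₗ e.symm.toLinearMap))) (Abelian.Ext.mk₀ 0)))
    refine LinearMap.ext fun x ↦ ?_
    have := LinearMap.congr_fun h0 (e ((LinearMap.range g).mkQ x))
    simpa using this
  obtain ⟨e₁⟩ := nonempty_quotient_range_equiv g hinj
  obtain ⟨N, hN, e₂⟩ := exists_bimoduleExt_transpose_equiv n g fun i hi ↦
    subsingleton_ext_congr e.symm (h (i + 1) (Nat.succ_lt_succ hi))
  obtain ⟨e₂⟩ := e₂ 0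
  rw [show 0 + n + 1 = n + 1 by rw [zero_add]] at e₂
  exact ⟨N, hN, ⟨(e.symm.trans e₁).trans e₂⟩⟩

/-- If every submodule of a module in `𝓔_{n+1}` has vanishing `Ext^j(-, A)` for `j ≤ n`, then
`𝓔_{n+1}` is submodule-closed. -/
lemma isSubmoduleClosed_extClass [IsNoetherianRing A] (n : ℕ)
    (h : ∀ M : ModuleCat.{u} A, extClass A A A (n + 1) M → ∀ X : Submodule A M, ∀ j, j < n + 1 →
      Subsingleton (Abelian.Ext.{u} (ModuleCat.of A X) (ModuleCat.of A A) j)) :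
    IsSubmoduleClosed (extClass A A A (n + 1)) := by
  intro M hM X _
  have := hM.1
  have : Module.Finite A (ModuleCat.of A X) := inferInstanceAs (Module.Finite A X)
  exact extClass_of_ext_eq_zero n _ (h M hM X)

end Dual

/-! ### Self-injective rings: reflexivity and degree zero -/

section SelfInjective

variable {A : Type u} [Ring A]

/-- If `A` is left self-injective and right noetherian, then every finitely generated right module
embeds in a finite free one. -/
lemma exists_embedding_of_injective [IsNoetherianRing A] [IsNoetherianRing Aᵐᵒᵖ]
    (hA : HasInjectiveDimensionLT (ModuleCat.of A A) 1)
    (T : Type u) [AddCommGroup T] [Module Aᵐᵒᵖ T] [Module.Finite Aᵐᵒᵖ T] :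
    ∃ (c : ℕ) (j : T →ₗ[Aᵐᵒᵖ] ((Fin c → A) →ₗ[A] A)), Function.Injective j := by
  obtain ⟨b, a, g, ⟨e⟩⟩ := exists_transpose_equiv (A := A) T
  obtain ⟨c, g', hg⟩ := exists_exact g
  obtain ⟨j, hj, -, -⟩ := exists_transpose_embedding (exact_dualMap hg
    (HasInjectiveDimensionLT.subsingleton _ 1 1 le_rfl _))
  exact ⟨c, j ∘ₗ e.symm.toLinearMap, hj.comp e.symm.injective⟩

/-- A left self-injective noetherian ring of finite right self-injective dimension has vanishing
`Ext^i(T, A)` for `i ≥ 1` and all finitely generated right modules `T`. -/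
lemma right_ext_eq_zero_of_left_injective [IsNoetherianRing A] [IsNoetherianRing Aᵐᵒᵖ]
    (hA : HasInjectiveDimensionLT (ModuleCat.of A A) 1) {m : ℕ}
    (hm : HasInjectiveDimensionLT (ModuleCat.of Aᵐᵒᵖ A) m) (d : ℕ) :
    ∀ (i : ℕ) (_ : m ≤ i + 1 + d) (T : Type u) [AddCommGroup T] [Module Aᵐᵒᵖ T]
      [Module.Finite Aᵐᵒᵖ T],
      Subsingleton (Abelian.Ext.{u} (ModuleCat.of Aᵐᵒᵖ T) (ModuleCat.of Aᵐᵒᵖ A) (i + 1)) := by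
  -- Descending induction on the degree, from `m` where the injective dimension kills everything:
  -- embedding `T` in a free module `F` bounds `Ext^{i+1}(T, A)` by `Ext^{i+2}(F/T, A)`.
  induction d with
  | zero => exact fun i hi T ↦ HasInjectiveDimensionLT.subsingleton _ m (i + 1) hi _
  | succ d ih =>
    intro i hi T _ _ _
    obtain ⟨c, j, hj⟩ := exists_embedding_of_injective hA T
    exact subsingleton_ext_of_exact_left hj (LinearMap.exact_map_mkQ_range j)
      (Submodule.mkQ_surjective _) (i + 1)
      (Abelian.Ext.subsingleton_of_projective
        (P := ModuleCat.of Aᵐᵒᵖ ((Fin c → A) →ₗ[A] A)) _ _)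
      (ih (i + 1) (by lia) _)

/-- If `Ext^1(T, A) = 0` for all finitely generated right modules `T`, then finitely generated left
modules are reflexive. -/
lemma evalDual_bijective [IsNoetherianRing A]
    (h : ∀ (T : Type u) [AddCommGroup T] [Module Aᵐᵒᵖ T] [Module.Finite Aᵐᵒᵖ T],
      Subsingleton (Abelian.Ext.{u} (ModuleCat.of Aᵐᵒᵖ T) (ModuleCat.of Aᵐᵒᵖ A) 1))
    (M : Type u) [AddCommGroup M] [Module A M] [Module.Finite A M] :
    Function.Bijective (evalDual A M) := by
  obtain ⟨b, p, hp⟩ := Module.Finite.exists_fin' A M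
  obtain ⟨a, g, hg⟩ := exists_exact p
  constructor
  · rw [injective_iff_map_eq_zero]
    intro x hx
    obtain ⟨y, rfl⟩ := hp x
    -- The kernel of `dualMap g` is `M*`, on which evaluation at `y` vanishes. So this evaluation
    -- factors through `dualMap g`; the factor is evaluation at some `z`, whence `y = g z` and `p y
    -- = 0`.
    obtain ⟨ψ, hψ⟩ := exists_factor_of_ext_one (dualMap g) (Y := ModuleCat.of Aᵐᵒᵖ A) (h _)
      (evalDual A _ y) fun φ hφ ↦ by
        have hk : LinearMap.ker p ≤ LinearMap.ker φ := fun z hz ↦ by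
          obtain ⟨w, rfl⟩ := (hg z).1 hz
          exact LinearMap.congr_fun hφ w
        have := LinearMap.congr_fun hx
          ((LinearMap.ker p).liftQ φ hk ∘ₗ (p.quotKerEquivOfSurjective hp).symm.toLinearMap)
        refine Eq.trans ?_ this
        have h1 : (p.quotKerEquivOfSurjective hp).symm (p y) = (LinearMap.ker p).mkQ y := by
          rw [LinearEquiv.symm_apply_eq]
          rfl
        change φ y = (LinearMap.ker p).liftQ φ hk ((p.quotKerEquivOfSurjective hp).symm (p y))
        rw [h1]
        rfl
    obtain ⟨z, rfl⟩ := (evalDual_pi_bijective a).surjective ψ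
    have : g z = y := (evalDual_pi_bijective b).injective hψ
    rw [← this, hg.apply_apply_eq_zero]
  · intro φ
    -- `dualMap p` is injective, so `φ` extends from `M*` to the dual of the free cover, where it is
    -- an evaluation.
    obtain ⟨ψ, hψ⟩ := exists_factor_of_ext_one (dualMap p) (Y := ModuleCat.of Aᵐᵒᵖ A) (h _) φ
      fun f hf ↦ by
        have : f = 0 := LinearMap.ext fun x ↦ by
          obtain ⟨y, rfl⟩ := hp x
          exact LinearMap.congr_fun hf y
        rw [this]
        exact zero_mem _
    obtain ⟨y, rfl⟩ := (evalDual_pi_bijective b).surjective ψ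
    exact ⟨p y, hψ⟩

/-- Over a left self-injective noetherian ring of finite right self-injective dimension, every
finitely generated left module is a dual. -/
lemma extClass_zero_of_injective [IsNoetherianRing A] [IsNoetherianRing Aᵐᵒᵖ]
    (hA : HasInjectiveDimensionLT (ModuleCat.of A A) 1) {m : ℕ}
    (hm : HasInjectiveDimensionLT (ModuleCat.of Aᵐᵒᵖ A) m) (M : ModuleCat.{u} A)
    [Module.Finite A M] : extClass A A A 0 M := by
  refine ⟨inferInstance, ModuleCat.of Aᵐᵒᵖ (M →ₗ[A] A), ?_, ⟨?_⟩⟩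
  · obtain ⟨b, p, hp⟩ := Module.Finite.exists_fin' A M
    have hinj : Function.Injective (dualMap p) := fun f f' hff ↦ LinearMap.ext fun x ↦ by
      obtain ⟨y, rfl⟩ := hp x
      exact LinearMap.congr_fun hff y
    have : IsNoetherian Aᵐᵒᵖ ((Fin b → A) →ₗ[A] A) := isNoetherian_of_isNoetherianRing_of_finite _ _
    exact Module.Finite.of_injective (dualMap p) hinj
  · exact (LinearEquiv.ofBijective _ (evalDual_bijective
      (fun T ↦ right_ext_eq_zero_of_left_injective hA hm m 0 (by lia) T) M)).trans
      (BimoduleExt.homEquiv A _)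

end SelfInjective

/-! ### Flat dimension and `Hom` from complexes of finite free modules -/

section FlatDimension

variable {A : Type u} [Ring A]

/-- Under `Hom(P, A) ⊗ I → Hom(P, I)`, with `P` finite free, this exhibits the tensor `∑ proj_i ⊗
φ(e_i)` as a preimage of `φ`. -/
lemma sum_smulRight_proj {a : ℕ} {I : Type u} [AddCommGroup I] [Module A I]
    (φ : (Fin a → A) →ₗ[A] I) :
    ∑ i, (LinearMap.proj i : (Fin a → A) →ₗ[A] A).smulRight (φ (Pi.single i 1)) = φ := by
  refine LinearMap.pi_ext' fun j ↦ LinearMap.ext_ring ?_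
  simp [Pi.single_apply]

lemma mk_tmul_eq_sum {a : ℕ} {I : Type u} [AddCommGroup I] [Module A I]
    (f : (Fin a → A) →ₗ[A] A) (x : I) :
    (QuotientAddGroup.mk (f ⊗ₜ[ℤ] x) : BalancedTensor A ((Fin a → A) →ₗ[A] A) I) =
      ∑ k, QuotientAddGroup.mk
        ((LinearMap.proj k : (Fin a → A) →ₗ[A] A) ⊗ₜ[ℤ] (f (Pi.single k 1) • x)) := by
  have hf : f = ∑ k, MulOpposite.op (f (Pi.single k 1)) • LinearMap.proj k := by
    refine LinearMap.pi_ext' fun j ↦ LinearMap.ext_ring ?_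
    simp [Pi.single_apply]
  conv_lhs => rw [hf, TensorProduct.sum_tmul, QuotientAddGroup.mk_sum]
  refine Finset.sum_congr rfl fun k _ ↦ (sub_eq_zero.1 ?_)
  rw [← QuotientAddGroup.mk_sub, QuotientAddGroup.eq_zero_iff]
  exact AddSubgroup.subset_closure ⟨_, _, _, rfl⟩

/-- The universal property of the balanced tensor product. -/
lemma BalancedTensor.exists_lift {K : Type u} [AddCommGroup K] [Module Aᵐᵒᵖ K] {I : Type u}
    [AddCommGroup I] [Module A I] {Q : Type u} [AddCommGroup Q] (γ : K →+ I →+ Q)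
    (h : ∀ (k : K) (r : A) (x : I), γ (MulOpposite.op r • k) x = γ k (r • x)) :
    ∃ Γ : BalancedTensor A K I →+ Q, ∀ k x, Γ (QuotientAddGroup.mk (k ⊗ₜ[ℤ] x)) = γ k x := by
  let L : K ⊗[ℤ] I →+ Q := TensorProduct.liftAddHom γ fun r m n ↦ by
    rw [map_zsmul, AddMonoidHom.zsmul_apply, map_zsmul]
  have hL (k : K) (x : I) : L (k ⊗ₜ[ℤ] x) = γ k x := TensorProduct.liftAddHom_tmul _ _ _ _
  refine ⟨QuotientAddGroup.lift _ L ?_, hL⟩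
  rw [balancedRelations, AddSubgroup.closure_le]
  rintro _ ⟨k, r, x, rfl⟩
  change L _ = 0
  rw [map_sub, hL, hL, h, sub_self]

lemma BalancedTensor.map_mk {N N' : Type u} [AddCommGroup N] [Module Aᵐᵒᵖ N]
    [AddCommGroup N'] [Module Aᵐᵒᵖ N'] (f : N →ₗ[Aᵐᵒᵖ] N') {M : Type u} [AddCommGroup M]
    [Module A M] (n : N) (m : M) :
    BalancedTensor.map A f M (QuotientAddGroup.mk (n ⊗ₜ[ℤ] m)) =
      QuotientAddGroup.mk (f n ⊗ₜ[ℤ] m) := rfl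

/-- For `f : P → A` and `x : I`, the map `p ↦ f p • x`, biadditively in `f` and `x`. -/
def smulRightAddHom (P I : Type u) [AddCommGroup P] [Module A P] [AddCommGroup I] [Module A I] :
    (P →ₗ[A] A) →+ I →+ (P →ₗ[A] I) where
  toFun f :=
    { toFun x := f.smulRight x
      map_zero' := LinearMap.ext fun _ ↦ smul_zero _
      map_add' _ _ := LinearMap.ext fun _ ↦ smul_add _ _ _ }
  map_zero' := AddMonoidHom.ext fun _ ↦ LinearMap.ext fun _ ↦ zero_smul _ _
  map_add' _ _ := AddMonoidHom.ext fun _ ↦ LinearMap.ext fun _ ↦ add_smul _ _ _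

/-- Precomposition with `g`, as an additive map. -/
def precompAddHom {P Q : Type u} [AddCommGroup P] [Module A P] [AddCommGroup Q] [Module A Q]
    (g : P →ₗ[A] Q) (I : Type u) [AddCommGroup I] [Module A I] : (Q →ₗ[A] I) →+ (P →ₗ[A] I) where
  toFun ψ := ψ ∘ₗ g
  map_zero' := LinearMap.zero_comp _
  map_add' _ _ := LinearMap.add_comp _ _ _

/-- For `L → P → Q` whose dual is exact, the image of `Hom(P, A) → Hom(L, A)` tensored with `I` maps
to the cokernel of `Hom(Q, I) → Hom(P, I)`. -/
lemma exists_tensor_range_hom {L P Q I : Type u} [AddCommGroup L] [Module A L] [AddCommGroup P]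
    [Module A P] [AddCommGroup Q] [Module A Q] [AddCommGroup I] [Module A I]
    {g₀ : L →ₗ[A] P} {g₁ : P →ₗ[A] Q} (hg : Function.Exact (dualMap g₁) (dualMap g₀)) :
    ∃ Γ : BalancedTensor A (LinearMap.range (dualMap g₀)) I →+
        ((P →ₗ[A] I) ⧸ (precompAddHom g₁ I).range),
      ∀ (f : P →ₗ[A] A) (x : I),
        Γ (QuotientAddGroup.mk ((dualMap g₀).rangeRestrict f ⊗ₜ[ℤ] x)) =
          QuotientAddGroup.mk (f.smulRight x) := by
  let π : (P →ₗ[A] A) →+ LinearMap.range (dualMap g₀) := (dualMap g₀).rangeRestrict.toAddMonoidHom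
  have hπ : Function.Surjective π := (dualMap g₀).surjective_rangeRestrict
  let β : (P →ₗ[A] A) →+ (I →+ ((P →ₗ[A] I) ⧸ (precompAddHom g₁ I).range)) :=
    (AddMonoidHom.compHom (QuotientAddGroup.mk' _)).comp (smulRightAddHom P I)
  have hβ : π.ker ≤ β.ker := by
    intro f hf
    obtain ⟨h, rfl⟩ := (hg f).1 (congrArg Subtype.val hf)
    refine AddMonoidHom.ext fun x ↦ (QuotientAddGroup.eq_zero_iff _).2 ⟨h.smulRight x, rfl⟩
  let γ := π.liftOfSurjective hπ ⟨β, hβ⟩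
  have hγ (f : P →ₗ[A] A) : γ (π f) = β f :=
    DFunLike.congr_fun (AddMonoidHom.liftOfRightInverse_comp _ _
      (Function.rightInverse_surjInv hπ) ⟨β, hβ⟩) f
  obtain ⟨Γ, hΓ⟩ := BalancedTensor.exists_lift γ fun k r x ↦ by
    obtain ⟨f, rfl⟩ := hπ k
    have : MulOpposite.op r • π f = π (MulOpposite.op r • f) :=
      ((dualMap g₀).rangeRestrict.map_smul _ f).symm
    rw [this, hγ, hγ]
    refine congrArg QuotientAddGroup.mk (LinearMap.ext fun p ↦ mul_smul (f p) r x)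
  refine ⟨Γ, fun f x ↦ (hΓ _ x).trans ?_⟩
  exact DFunLike.congr_fun (hγ f) x

/-- The tensor corresponds to `φ ∘ g₀` under `Hom(L, A) ⊗ I ≅ Hom(L, I)`: expanded in the coordinate
projections, its `k`-th coefficient is `φ (g₀ e_k) = 0`. -/
lemma sum_mk_tmul_eq_zero {I : Type u} [AddCommGroup I] [Module A I] {a b : ℕ}
    (g₀ : (Fin a → A) →ₗ[A] (Fin b → A)) (φ : (Fin b → A) →ₗ[A] I) (hφ : φ ∘ₗ g₀ = 0) :
    (∑ i, QuotientAddGroup.mk (dualMap g₀ (LinearMap.proj i) ⊗ₜ[ℤ] φ (Pi.single i 1)) :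
      BalancedTensor A ((Fin a → A) →ₗ[A] A) I) = 0 := by
  rw [Finset.sum_congr rfl fun i _ ↦ mk_tmul_eq_sum _ _, Finset.sum_comm]
  refine Finset.sum_eq_zero fun k _ ↦ ?_
  have h2 : ∑ i, dualMap g₀ (LinearMap.proj i) (Pi.single k 1) • φ (Pi.single i 1) = 0 := by
    refine Eq.trans ?_ (LinearMap.congr_fun hφ (Pi.single k 1))
    conv_rhs => rw [LinearMap.comp_apply, ← sum_smulRight_proj φ]
    simp
  rw [← QuotientAddGroup.mk_sum, ← TensorProduct.tmul_sum, h2, TensorProduct.tmul_zero,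
    QuotientAddGroup.mk_zero]

/-- Homomorphisms from finite free modules to a flat module `I` inherit exactness from the dual
sequence: this is exactness of `- ⊗ I`, since `Hom(P, A) ⊗ I = Hom(P, I)` for `P` finite free. -/
lemma IsFlat.exists_factor {I : Type u} [AddCommGroup I] [Module A I] (hI : IsFlat A I)
    {a b c : ℕ} {g₀ : (Fin a → A) →ₗ[A] (Fin b → A)} {g₁ : (Fin b → A) →ₗ[A] (Fin c → A)}
    (hg : Function.Exact (dualMap g₁) (dualMap g₀)) (φ : (Fin b → A) →ₗ[A] I)
    (hφ : φ ∘ₗ g₀ = 0) : ∃ ψ : (Fin c → A) →ₗ[A] I, ψ ∘ₗ g₁ = φ := by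
  obtain ⟨Γ, hΓ⟩ := exists_tensor_range_hom (I := I) hg
  have ht : (∑ i, QuotientAddGroup.mk
      ((dualMap g₀).rangeRestrict (LinearMap.proj i) ⊗ₜ[ℤ] φ (Pi.single i 1)) :
        BalancedTensor A (LinearMap.range (dualMap g₀)) I) = 0 := by
    -- Flatness enters here: the tensor vanishes in the larger module `L* ⊗ I`, hence already in the
    -- tensor product of `I` with the image of `P* → L*`. There `Γ` turns it into the class of `φ`
    -- modulo maps factoring through `g₁`.
    refine (injective_iff_map_eq_zero _).1 (hI _ _ (LinearMap.range (dualMap g₀)).subtype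
      (LinearMap.range (dualMap g₀)).injective_subtype) _ ?_
    rw [map_sum]
    refine (Finset.sum_congr rfl fun i _ ↦ BalancedTensor.map_mk _
      ((dualMap g₀).rangeRestrict (LinearMap.proj i)) _).trans ?_
    exact sum_mk_tmul_eq_zero g₀ φ hφ
  have h1 := congrArg Γ ht
  rw [map_sum, Finset.sum_congr rfl fun i _ ↦ hΓ _ _, ← QuotientAddGroup.mk_sum,
    sum_smulRight_proj, map_zero] at h1
  exact (QuotientAddGroup.eq_zero_iff _).1 h1

/-- Functionals separate the points of a finite free module. -/
lemma comp_eq_zero_of_dualMap {a b c : ℕ} {g₀ : (Fin a → A) →ₗ[A] (Fin b → A)}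
    {g₁ : (Fin b → A) →ₗ[A] (Fin c → A)} (hg : Function.Exact (dualMap g₁) (dualMap g₀)) :
    g₁ ∘ₗ g₀ = 0 := by
  refine LinearMap.ext fun x ↦ (evalDual_pi_bijective c).injective (LinearMap.ext fun f ↦ ?_)
  exact (LinearMap.congr_fun (hg.apply_apply_eq_zero f) x).trans (map_zero f).symm

/-- If the dual of a sequence of finite free modules is exact, then applying `Hom(-, I)` to it
yields a sequence that is exact in degrees above the flat dimension of `I`. -/
lemma FlatDimLE.exists_factor (j : ℕ) :
    ∀ (I : Type u) [AddCommGroup I] [Module A I], FlatDimLE A j I →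
    ∀ (a : ℕ → ℕ) (g : ∀ i, (Fin (a i) → A) →ₗ[A] (Fin (a (i + 1)) → A)),
      (∀ i, Function.Exact (dualMap (g (i + 1))) (dualMap (g i))) →
      ∀ (d : ℕ) (φ : (Fin (a (d + j + 1)) → A) →ₗ[A] I), φ ∘ₗ g (d + j) = 0 →
        ∃ ψ : (Fin (a (d + j + 2)) → A) →ₗ[A] I, ψ ∘ₗ g (d + j + 1) = φ := by
  induction j with
  | zero => exact fun I _ _ hI a g hg d φ hφ ↦ IsFlat.exists_factor hI (hg d) φ hφ
  | succ j ih =>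
    rintro I _ _ ⟨F, p, hF, hp, hK⟩ a g hg d φ hφ
    -- A diagram chase along `0 → ker p → F → I → 0`. The lift `φ'` restricts along `g` to a map `θ`
    -- into `ker p`, one place earlier in the sequence; by induction `θ` factors through some `ψ`.
    -- The correction `φ' - ψ` then composes to zero with `g`, so it factors by flatness of `F`, and
    -- `p` kills the correcting term.
    obtain ⟨φ', hφ'⟩ := Module.projective_lifting_property p φ hp
    let θ : (Fin (a (d + j + 1)) → A) →ₗ[A] LinearMap.ker p :=
      (φ' ∘ₗ g (d + j + 1)).codRestrict _ fun x ↦ by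
        have := LinearMap.congr_fun hφ x
        rw [← hφ'] at this
        exact this
    have hgg (i : ℕ) : g (i + 1) ∘ₗ g i = 0 := comp_eq_zero_of_dualMap (hg i)
    obtain ⟨ψ, hψ⟩ := ih (LinearMap.ker p) hK a g hg d θ <| by
      ext1 x
      refine LinearMap.ext fun x ↦ Subtype.ext ?_
      change φ' ((g (d + j + 1) ∘ₗ g (d + j)) _) = 0
      rw [hgg, LinearMap.zero_apply, map_zero]
    obtain ⟨χ, hχ⟩ := IsFlat.exists_factor hF (hg (d + j + 1))
      (φ' - (LinearMap.ker p).subtype ∘ₗ ψ) <| by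
      refine LinearMap.ext fun x ↦ ?_
      have := congrArg Subtype.val (LinearMap.congr_fun hψ x)
      exact sub_eq_zero.2 this.symm
    refine ⟨p ∘ₗ χ, ?_⟩
    change p ∘ₗ (χ ∘ₗ g (d + j + 1 + 1)) = φ
    rw [hχ, ← hφ', LinearMap.comp_sub]
    refine sub_eq_self.2 (LinearMap.ext fun x ↦ (ψ x).2)

/-- Every finitely generated right module over a right noetherian ring has a resolution by duals of
finite free left modules. -/
lemma exists_resolution [IsNoetherianRing Aᵐᵒᵖ] (N : Type u) [AddCommGroup N] [Module Aᵐᵒᵖ N]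
    [Module.Finite Aᵐᵒᵖ N] :
    ∃ (a : ℕ → ℕ) (g : ∀ i, (Fin (a i) → A) →ₗ[A] (Fin (a (i + 1)) → A)),
      (∀ i, Function.Exact (dualMap (g (i + 1))) (dualMap (g i))) ∧
      Nonempty (Transpose (g 0) ≃ₗ[Aᵐᵒᵖ] N) := by
  obtain ⟨a₀, a₁, g₀, e⟩ := exists_transpose_equiv (A := A) N
  have next (s : Σ (a b : ℕ), (Fin a → A) →ₗ[A] (Fin b → A)) :
      ∃ (c : ℕ) (g : (Fin s.2.1 → A) →ₗ[A] (Fin c → A)),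
        Function.Exact (dualMap g) (dualMap s.2.2) := by
    obtain ⟨c, g, hg⟩ := exists_range_dualMap_eq (LinearMap.ker (dualMap s.2.2))
    exact ⟨c, g, LinearMap.exact_iff.2 hg.symm⟩
  choose c g hg using next
  let s : ℕ → Σ (a b : ℕ), (Fin a → A) →ₗ[A] (Fin b → A) :=
    fun n ↦ Nat.rec ⟨a₀, a₁, g₀⟩ (fun _ s ↦ ⟨s.2.1, c s, g s⟩) n
  exact ⟨fun i ↦ (s i).1, fun i ↦ (s i).2.2, fun i ↦ hg (s i), e⟩

/-- Dimension shifting along a resolution. -/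
lemma nonempty_bimoduleExt_transpose_equiv (a : ℕ → ℕ)
    (g : ∀ i, (Fin (a i) → A) →ₗ[A] (Fin (a (i + 1)) → A))
    (hg : ∀ i, Function.Exact (dualMap (g (i + 1))) (dualMap (g i))) (n : ℕ) :
    ∀ m, Nonempty (BimoduleExt A A (ModuleCat.of Aᵐᵒᵖ (Transpose (g n))) (m + 1) ≃ₗ[A]
      BimoduleExt A A (ModuleCat.of Aᵐᵒᵖ (Transpose (g 0))) (n + m + 1)) := by
  induction n with
  | zero => exact fun m ↦ by rw [Nat.zero_add m]; exact ⟨LinearEquiv.refl _ _⟩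
  | succ n ih =>
    intro m
    obtain ⟨e⟩ := ih (m + 1)
    obtain ⟨j, hj, -, hjr⟩ := exists_transpose_embedding (hg n)
    obtain ⟨e₁⟩ := BimoduleExt.nonempty_shift A A hj hjr (Submodule.mkQ_surjective _) m
    rw [show n + 1 + m + 1 = n + (m + 1) + 1 by ring]
    exact ⟨e₁.trans e⟩

end FlatDimension

/-! ### The Auslander condition and maps into injectives of bounded flat dimension -/

section Auslander

variable {A : Type u} [Ring A]

/-- There are no non-zero homomorphisms from `Ext^{n+1}(N, A)` to an injective module of flat
dimension at most `n`. -/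
lemma hom_bimoduleExt_eq_zero [IsNoetherianRing Aᵐᵒᵖ] {n j : ℕ} (hj : j ≤ n)
    (N : ModuleCat.{u} Aᵐᵒᵖ) [Module.Finite Aᵐᵒᵖ N] (I : Type u) [AddCommGroup I] [Module A I]
    [Module.Injective A I] (hI : FlatDimLE A j I) (φ : BimoduleExt A A N (n + 1) →ₗ[A] I) :
    φ = 0 := by
  obtain ⟨a, g, hg, ⟨e⟩⟩ := exists_resolution (A := A) N
  obtain ⟨e₁⟩ := nonempty_bimoduleExt_transpose_equiv a g hg n 0
  let e₂ : BimoduleExt A A N (n + 1) →ₗ[A]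
      BimoduleExt A A (ModuleCat.of Aᵐᵒᵖ (Transpose (g 0))) (n + 1) :=
    BimoduleExt.precomp A (Abelian.Ext.mk₀ e.toModuleIso.hom) (zero_add _)
  let e₃ : BimoduleExt A A (ModuleCat.of Aᵐᵒᵖ (Transpose (g 0))) (n + 1) →ₗ[A]
      BimoduleExt A A N (n + 1) :=
    BimoduleExt.precomp A (Abelian.Ext.mk₀ e.toModuleIso.inv) (zero_add _)
  have he (x : BimoduleExt A A N (n + 1)) : e₃ (e₂ x) = x :=
    ext_inv_comp_hom_comp (Y := ModuleCat.of Aᵐᵒᵖ A) e.toModuleIso x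
  -- `Tr (g n)` is an `n`-th syzygy of `N`, so dimension shifting leaves only `Ext^1`.
  suffices h : ∀ θ : BimoduleExt A A (ModuleCat.of Aᵐᵒᵖ (Transpose (g n))) 1 →ₗ[A] I, θ = 0 by
    ext1 x
    have := LinearMap.congr_fun (h (φ ∘ₗ e₃ ∘ₗ e₁.toLinearMap)) (e₁.symm (e₂ x))
    change φ (e₃ (e₁ (e₁.symm (e₂ x)))) = 0 at this
    rwa [e₁.apply_symm_apply, he] at this
  intro θ
  obtain ⟨i, hi, him, hie⟩ := exists_transpose_embedding (hg n)
  obtain ⟨δ, hδ, hk⟩ := BimoduleExt.exists_connecting A A hi hie (Submodule.mkQ_surjective _)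
  let e' := LinearEquiv.ofBijective _ (evalDual_pi_bijective (A := A) (a (n + 1)))
  let π := (LinearMap.range (dualMap (g (n + 1)))).mkQ
  let ι : (Transpose (g (n + 1)) →ₗ[Aᵐᵒᵖ] A) →ₗ[A] (Fin (a (n + 1)) → A) :=
    e'.symm.toLinearMap ∘ₗ
      { toFun χ := χ ∘ₗ π
        map_add' _ _ := rfl
        map_smul' _ _ := rfl }
  have hι (χ) : evalDual A _ (ι χ) = χ ∘ₗ π := e'.apply_symm_apply _
  have hinj : Function.Injective ι := e'.symm.injective.comp fun χ χ' h ↦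
    LinearMap.ext fun x ↦ by
      obtain ⟨y, rfl⟩ := Submodule.mkQ_surjective _ x
      exact LinearMap.congr_fun h y
  -- `ι` identifies the source of `δ` with cocycles in a free module, and injectivity of `I` extends
  -- `θ ∘ δ` to all cochains. Since `δ` kills coboundaries, `Φ` kills the image of `g n`; the flat
  -- dimension bound then makes `Φ` factor through `g (n + 1)`, which vanishes on cocycles.
  obtain ⟨Φ, hΦ⟩ := Module.Injective.out ι hinj (θ ∘ₗ δ)
  obtain ⟨d, rfl⟩ := Nat.exists_eq_add_of_le' hj
  obtain ⟨Ψ, hΨ⟩ := FlatDimLE.exists_factor j I hI a g hg d Φ <| by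
    refine LinearMap.ext fun x ↦ ?_
    let χ := evalDual A _ x ∘ₗ i
    have hx : ι χ = g (d + j) x := by
      refine (evalDual_pi_bijective _).injective ((hι χ).trans ?_)
      change evalDual A _ x ∘ₗ (i ∘ₗ π) = _
      rw [him]
      rfl
    have h0 : δ χ = 0 := (hk χ).2 ⟨_, rfl⟩
    rw [LinearMap.comp_apply, ← hx, hΦ, LinearMap.comp_apply, h0, map_zero]
    rfl
  ext1 y
  obtain ⟨χ, rfl⟩ := hδ y
  have h1 : g (d + j + 1) (ι χ) = 0 := by
    refine (evalDual_pi_bijective _).injective (LinearMap.ext fun f ↦ ?_)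
    rw [map_zero]
    refine (LinearMap.congr_fun (hι χ) (f ∘ₗ g (d + j + 1))).trans ?_
    have : π (f ∘ₗ g (d + j + 1)) = 0 := (Submodule.Quotient.mk_eq_zero _).2 ⟨f, rfl⟩
    rw [LinearMap.comp_apply, this, map_zero]
    rfl
  have := hΦ χ
  rw [← hΨ, LinearMap.comp_apply, h1, map_zero] at this
  exact this.symm

/-- Under the Auslander condition, submodules `X` of modules in `𝓔_{n+1}` satisfy `Ext^j(X, A) = 0`
for `j ≤ n`. -/
lemma AuslanderCondition.subsingleton_ext [IsNoetherianRing Aᵐᵒᵖ] (hA : AuslanderCondition A)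
    (n : ℕ) (M : ModuleCat.{u} A) (hM : extClass A A A (n + 1) M) (X : Submodule A M) (j : ℕ)
    (hj : j < n + 1) :
    Subsingleton (Abelian.Ext.{u} (ModuleCat.of A X) (ModuleCat.of A A) j) := by
  obtain ⟨I, -, hI⟩ := hA
  obtain ⟨-, N, hN, ⟨e⟩⟩ := hM
  refine subsingleton_of_forall_eq 0 fun x ↦ ?_
  obtain ⟨f, hf, rfl⟩ := I.extMk_surjective x (j + 1) rfl
  have : Injective (I.cocomplex.X j) := I.injective j
  have : Module.Injective A (I.cocomplex.X j) :=
    Module.injective_module_of_injective_object A (I.cocomplex.X j)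
  -- The representing map `f : X → I_j` extends to all of `M ≅ Ext^{n+1}(N, A)`, where no non-zero
  -- map to `I_j` exists.
  obtain ⟨F, hF⟩ := Module.Injective.out X.subtype X.injective_subtype f.hom
  have h0 := hom_bimoduleExt_eq_zero (Nat.lt_succ_iff.1 hj) N (I.cocomplex.X j) (hI j)
    (F ∘ₗ e.symm.toLinearMap)
  have : f = 0 := by
    ext y
    rw [← hF y]
    have := LinearMap.congr_fun h0 (e (X.subtype y))
    rw [LinearMap.comp_apply, LinearEquiv.coe_coe, e.symm_apply_apply] at this
    exact this
  subst this
  exact I.extMk_zero _ _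

end Auslander

/-! ### Supports of `Ext` over a commutative noetherian ring -/

section Commutative

variable {A : Type u} [CommRing A]

lemma notMem_support_of_exact {E₁ E₂ E₃ : Type u} [AddCommGroup E₁] [Module A E₁]
    [AddCommGroup E₂] [Module A E₂] [AddCommGroup E₃] [Module A E₃] {f : E₁ →ₗ[A] E₂}
    {g : E₂ →ₗ[A] E₃} (h : Function.Exact f g) {p : PrimeSpectrum A}
    (h₁ : p ∉ Module.support A E₁) (h₃ : p ∉ Module.support A E₃) : p ∉ Module.support A E₂ := by
  rw [Module.notMem_support_iff'] at *
  intro e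
  obtain ⟨r, hr, hre⟩ := h₃ (g e)
  obtain ⟨e', he'⟩ := (h (r • e)).1 (by rw [map_smul, hre])
  obtain ⟨s, hs, hse⟩ := h₁ e'
  refine ⟨s * r, fun hmem ↦ (p.2.mem_or_mem hmem).elim hs hr, ?_⟩
  rw [mul_smul, ← he', ← map_smul, hse, map_zero]

lemma mem_support_of_equiv_quotient {N : Type u} [AddCommGroup N] [Module A N]
    (p : PrimeSpectrum A) (e : N ≃ₗ[A] A ⧸ p.asIdeal) : p ∈ Module.support A N := by
  rw [e.support_eq, Module.mem_support_iff']
  refine ⟨Ideal.Quotient.mk _ 1, fun r hr h ↦ hr ?_⟩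
  rw [← Ideal.Quotient.eq_zero_iff_mem]
  refine Eq.trans ?_ h
  rw [← Ideal.Quotient.mkₐ_eq_mk A, ← map_smul]
  simp

section ExtLinear

variable {K F N : Type u} [AddCommGroup K] [Module A K]
  [AddCommGroup F] [Module A F] [AddCommGroup N] [Module A N]
  {f : K →ₗ[A] F} {g : F →ₗ[A] N}

/-- Composition with an extension class in the first variable, as an `A`-linear map. -/
noncomputable abbrev extPrecomp {X X' : ModuleCat.{u} A} (U : ModuleCat.{u} A) {a b c : ℕ}
    (α : Abelian.Ext.{u} X X' a) (h : a + b = c) :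
    Abelian.Ext.{u} X' U b →ₗ[A] Abelian.Ext.{u} X U c :=
  Abelian.Ext.bilinearCompOfLinear A X X' U a b c h α

/-- Transfers scalars from `N` to `Ext`: an element killing `N` kills `Ext(N, U)`, and the sequence
of multiplication by `x` on `N` induces multiplication by `x` on `Ext`. -/
lemma smul_eq_mk₀_comp (U : ModuleCat.{u} A) {n : ℕ} (r : A)
    (x : Abelian.Ext.{u} (ModuleCat.of A N) U n) :
    (Abelian.Ext.mk₀ (ModuleCat.ofHom (LinearMap.lsmul A N r))).comp x (zero_add n) = r • x := by
  have : ModuleCat.ofHom (LinearMap.lsmul A N r) = r • 𝟙 (ModuleCat.of A N) := rfl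
  rw [this, Abelian.Ext.mk₀_smul, Abelian.Ext.smul_comp, Abelian.Ext.mk₀_id_comp]

lemma notMem_support_ext_middle (U : ModuleCat.{u} A) (hf : Function.Injective f)
    (hfg : Function.Exact f g) (hg : Function.Surjective g) {p : PrimeSpectrum A} (n : ℕ)
    (hK : p ∉ Module.support A (Abelian.Ext.{u} (ModuleCat.of A K) U n))
    (hN : p ∉ Module.support A (Abelian.Ext.{u} (ModuleCat.of A N) U n)) :
    p ∉ Module.support A (Abelian.Ext.{u} (ModuleCat.of A F) U n) := by
  have hS := shortExact_exactComplex hf hfg hg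
  refine notMem_support_of_exact (f := extPrecomp U (Abelian.Ext.mk₀ (ModuleCat.ofHom g))
    (zero_add n)) (g := extPrecomp U (Abelian.Ext.mk₀ (ModuleCat.ofHom f)) (zero_add n))
    (fun x ↦ ⟨Abelian.Ext.contravariant_sequence_exact₂ hS U x, ?_⟩) hN hK
  rintro ⟨y, rfl⟩
  change (Abelian.Ext.mk₀ (ModuleCat.ofHom f)).comp
    ((Abelian.Ext.mk₀ (ModuleCat.ofHom g)).comp y (zero_add n)) (zero_add n) = 0
  have hz : ModuleCat.ofHom f ≫ ModuleCat.ofHom g = 0 := (exactComplex hfg).zero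
  rw [Abelian.Ext.mk₀_comp_mk₀_assoc, hz, Abelian.Ext.mk₀_zero, Abelian.Ext.zero_comp]

lemma notMem_support_ext_left (U : ModuleCat.{u} A) (hf : Function.Injective f)
    (hfg : Function.Exact f g) (hg : Function.Surjective g) {p : PrimeSpectrum A} (n : ℕ)
    (hF : p ∉ Module.support A (Abelian.Ext.{u} (ModuleCat.of A F) U n))
    (hN : p ∉ Module.support A (Abelian.Ext.{u} (ModuleCat.of A N) U (n + 1))) :
    p ∉ Module.support A (Abelian.Ext.{u} (ModuleCat.of A K) U n) := by
  have hS := shortExact_exactComplex hf hfg hg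
  refine notMem_support_of_exact (f := extPrecomp U (Abelian.Ext.mk₀ (ModuleCat.ofHom f))
    (zero_add n)) (g := extPrecomp U hS.extClass (add_comm 1 n))
    (fun x ↦ ⟨Abelian.Ext.contravariant_sequence_exact₁ hS U x (add_comm 1 n), ?_⟩) hF hN
  rintro ⟨y, rfl⟩
  exact hS.extClass_comp_assoc _ (h := add_comm 1 n)

lemma support_ext_congr (U : ModuleCat.{u} A) (e : K ≃ₗ[A] N) (n : ℕ) :
    Module.support A (Abelian.Ext.{u} (ModuleCat.of A N) U n) ⊆
      Module.support A (Abelian.Ext.{u} (ModuleCat.of A K) U n) :=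
  Module.support_subset_of_injective
    (extPrecomp U (Abelian.Ext.mk₀ e.toModuleIso.hom) (zero_add n))
    (Function.LeftInverse.injective
      (g := extPrecomp U (Abelian.Ext.mk₀ e.toModuleIso.inv) (zero_add n))
      (ext_inv_comp_hom_comp e.toModuleIso))

lemma lsmul_injective_of_equiv_quotient (q : PrimeSpectrum A) (e : N ≃ₗ[A] A ⧸ q.asIdeal) {x : A}
    (hx : x ∉ q.asIdeal) : Function.Injective (LinearMap.lsmul A N x) := by
  rw [injective_iff_map_eq_zero]
  intro y hy
  obtain ⟨a, ha⟩ := Ideal.Quotient.mk_surjective (e y)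
  have h : x • e y = 0 := by
    rw [← map_smul]
    exact (congrArg e hy).trans (map_zero e)
  rw [← ha, ← Ideal.Quotient.mkₐ_eq_mk A, ← map_smul, Ideal.Quotient.mkₐ_eq_mk,
    Ideal.Quotient.eq_zero_iff_mem] at h
  have h' := (q.2.mem_or_mem h).resolve_left hx
  rw [← e.map_eq_zero_iff, ← ha, Ideal.Quotient.eq_zero_iff_mem]
  exact h'

variable [IsNoetherianRing A]

/-- Nakayama's lemma for `Ext`: if `x ∈ p` is regular on `N` and `Ext^{n+1}(N/xN, U)` vanishes at `p`,
then so does `Ext^n(N, U)`. -/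
lemma notMem_support_ext_of_regular (U : ModuleCat.{u} A) [Module.Finite A U] [Module.Finite A N]
    {p : PrimeSpectrum A} {x : A} (hx : x ∈ p.asIdeal)
    (hreg : Function.Injective (LinearMap.lsmul A N x)) (n : ℕ)
    (h : p ∉ Module.support A (Abelian.Ext.{u}
      (ModuleCat.of A (N ⧸ LinearMap.range (LinearMap.lsmul A N x))) U (n + 1))) :
    p ∉ Module.support A (Abelian.Ext.{u} (ModuleCat.of A N) U n) := by
  intro hp
  have : Module.Finite A (ModuleCat.of A N) := inferInstanceAs (Module.Finite A N)
  have hS := shortExact_exactComplex hreg (LinearMap.exact_map_mkQ_range _)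
    (Submodule.mkQ_surjective _)
  -- Nakayama at `p`: as `x ∈ p`, a non-zero localization of the finitely generated module `Ext^n(N,
  -- U)` stays non-zero modulo `x`. But that quotient embeds in `Ext^{n+1}(N/xN, U)`.
  have h₁ : p ∈ Module.support A (QuotSMulTop x (Abelian.Ext.{u} (ModuleCat.of A N) U n)) := by
    rw [Module.support_quotSMulTop]
    exact ⟨hp, by simpa using hx⟩
  rw [Module.mem_support_iff'] at h₁
  rw [Module.notMem_support_iff'] at h
  obtain ⟨e, he⟩ := h₁
  obtain ⟨e, rfl⟩ := Submodule.mkQ_surjective _ e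
  obtain ⟨r, hr, hre⟩ := h (extPrecomp U hS.extClass (add_comm 1 n) e)
  rw [← map_smul] at hre
  obtain ⟨e', he'⟩ := Abelian.Ext.contravariant_sequence_exact₁ hS U (r • e) (add_comm 1 n) hre
  refine he r hr ?_
  rw [← map_smul, Submodule.mkQ_apply, Submodule.Quotient.mk_eq_zero]
  exact ⟨e', trivial, (smul_eq_mk₀_comp U x e').symm.trans he'⟩

/-- If `Ext^{n+1}(-, U)` vanishes at `p` on finitely generated modules, then so does `Ext^n(-, U)`,
provided that `Ext^n(A/p, U)` does. -/
lemma notMem_support_ext (U : ModuleCat.{u} A) [Module.Finite A U] (p : PrimeSpectrum A) (n : ℕ)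
    (h : ∀ (N : Type u) [AddCommGroup N] [Module A N] [Module.Finite A N],
      p ∉ Module.support A (Abelian.Ext.{u} (ModuleCat.of A N) U (n + 1)))
    (hp : p ∉ Module.support A (Abelian.Ext.{u} (ModuleCat.of A (A ⧸ p.asIdeal)) U n))
    (N : Type u) [AddCommGroup N] [Module A N] [hN : Module.Finite A N] :
    p ∉ Module.support A (Abelian.Ext.{u} (ModuleCat.of A N) U n) := by
  induction hN using IsNoetherianRing.induction_on_isQuotientEquivQuotientPrime A with
  | subsingleton N =>
    have : Subsingleton (Abelian.Ext.{u} (ModuleCat.of A N) U n) := by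
      refine subsingleton_of_forall_eq 0 fun x ↦ ?_
      rw [← one_smul A x, ← smul_eq_mk₀_comp U 1 x, Subsingleton.elim (LinearMap.lsmul A N 1) 0,
        ModuleCat.ofHom_zero, Abelian.Ext.mk₀_zero, Abelian.Ext.zero_comp]
    rw [Module.support_eq_empty]
    exact Set.notMem_empty _
  | quotient N q e =>
    -- For `A/q`: if `q = p`, use `hp`; if `q ⊊ p`, an element of `p \ q` is regular on `A/q`; if `q
    -- ⊄ p`, an element of `q \ p` kills `A/q`, hence its `Ext`.
    by_cases hqp : q.asIdeal ≤ p.asIdeal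
    · by_cases hpq : p.asIdeal ≤ q.asIdeal
      · obtain rfl : q = p := PrimeSpectrum.ext (le_antisymm hqp hpq)
        exact fun h' ↦ hp (support_ext_congr U e.symm n h')
      · obtain ⟨x, hx, hxq⟩ := SetLike.not_le_iff_exists.1 hpq
        exact notMem_support_ext_of_regular U hx (lsmul_injective_of_equiv_quotient q e hxq) n (h _)
    · obtain ⟨s, hs, hsp⟩ := SetLike.not_le_iff_exists.1 hqp
      rw [Module.notMem_support_iff']
      refine fun x ↦ ⟨s, hsp, ?_⟩
      have : LinearMap.lsmul A N s = 0 := by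
        ext y
        apply e.injective
        obtain ⟨a, ha⟩ := Ideal.Quotient.mk_surjective (e y)
        rw [LinearMap.lsmul_apply, map_smul, ← ha, LinearMap.zero_apply, map_zero,
          ← Ideal.Quotient.mkₐ_eq_mk A, ← map_smul, Ideal.Quotient.mkₐ_eq_mk,
          Ideal.Quotient.eq_zero_iff_mem]
        exact Ideal.mul_mem_right _ _ hs
      rw [← smul_eq_mk₀_comp, this, ModuleCat.ofHom_zero, Abelian.Ext.mk₀_zero,
        Abelian.Ext.zero_comp]
  | exact N₁ N₂ N₃ f g hf hg hfg h₁ h₃ =>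
    exact notMem_support_ext_middle U hf hfg hg n h₁ h₃

end ExtLinear

end Commutative

/-! ### Associated primes, Rees' induction and vanishing of low `Ext` -/

section CommutativeGrade

variable {A : Type u} [CommRing A]

lemma injective_of_quotient_maximal {𝔪 : Ideal A} (h𝔪 : 𝔪.IsMaximal) {C : Type u} [AddCommGroup C]
    [Module A C] (f : (A ⧸ 𝔪) →ₗ[A] C) (hf : f ≠ 0) : Function.Injective f := by
  have : IsSimpleModule A (A ⧸ 𝔪) := isSimpleModule_iff_isCoatom.2 h𝔪.1
  exact (f.injective_or_eq_zero).resolve_right hf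

variable [IsNoetherianRing A]

/-- If `U` has finite injective dimension and `Ext^i(U, U) = 0` for `i > 0`, then `Ext^i(N, U)`
vanishes for `i > 0` at every associated prime of `U`. -/
lemma notMem_support_ext_of_embedding (U : ModuleCat.{u} A) [Module.Finite A U] {m : ℕ}
    (hm : HasInjectiveDimensionLT U m) (hU : ∀ i, Subsingleton (Abelian.Ext.{u} U U (i + 1)))
    (p : PrimeSpectrum A) (f : (A ⧸ p.asIdeal) →ₗ[A] U) (hf : Function.Injective f) (k : ℕ) :
    ∀ (d : ℕ) (_ : m ≤ d + 1 + k) (N : Type u) [AddCommGroup N] [Module A N] [Module.Finite A N],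
      p ∉ Module.support A (Abelian.Ext.{u} (ModuleCat.of A N) U (d + 1)) := by
  induction k with
  | zero =>
    intro d hd N _ _ _
    have := HasInjectiveDimensionLT.subsingleton U m (d + 1) hd (ModuleCat.of A N)
    rw [Module.support_eq_empty]
    exact Set.notMem_empty _
  | succ k ih =>
    intro d hd N _ _ _
    -- Descending induction on the degree. By the previous lemmas only `A/p` matters, and `A/p ⊆ U`
    -- places its `Ext^{d+1}` between `Ext^{d+1}(U, U) = 0` and `Ext^{d+2}` of the cokernel.
    refine notMem_support_ext U p (d + 1) (ih (d + 1) (by lia)) ?_ N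
    refine notMem_support_ext_left U hf (LinearMap.exact_map_mkQ_range _)
      (Submodule.mkQ_surjective _) (d + 1) ?_ (ih (d + 1) (by lia) _)
    have := hU d
    have : Module.support A (Abelian.Ext.{u} U U (d + 1)) = ∅ := Module.support_eq_empty
    exact fun h ↦ Set.notMem_empty p (this ▸ h)

/-- A finitely generated module into which the residue field at a maximal ideal does not embed has a
regular element in that ideal. -/
lemma exists_regular_of_hom_eq_zero {𝔪 : Ideal A} (h𝔪 : 𝔪.IsMaximal) (C : Type u) [AddCommGroup C]
    [Module A C] [Module.Finite A C] (h : ∀ f : (A ⧸ 𝔪) →ₗ[A] C, f = 0) :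
    ∃ x ∈ 𝔪, Function.Injective (LinearMap.lsmul A C x) := by
  by_contra! hcon
  -- If `𝔪` consists of zero divisors, prime avoidance makes it an associated prime, which gives a
  -- non-zero map `A/𝔪 → C`.
  have hsub : (𝔪 : Set A) ⊆ ⋃ P ∈ associatedPrimes A C, (P : Set A) := by
    rw [biUnion_associatedPrimes_eq_zero_divisors]
    intro x hx
    have := hcon x hx
    rw [injective_iff_map_eq_zero] at this
    push Not at this
    obtain ⟨c, hc, hc0⟩ := this
    exact ⟨c, hc0, hc⟩
  obtain ⟨P, hP, hle⟩ := (𝔪.subset_union_prime_finite (associatedPrimes.finite A C) (f := id) 0 0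
    fun _ h _ _ ↦ h.isPrime).1 hsub
  obtain rfl : 𝔪 = P := h𝔪.eq_of_le hP.isPrime.ne_top hle
  obtain ⟨-, c, hc⟩ := (isAssociatedPrime_iff (R := A)).1 hP
  have hle' : 𝔪 ≤ LinearMap.ker (LinearMap.toSpanSingleton A C c) := by
    rw [hc]
    intro r hr
    simpa [Submodule.mem_colon_singleton] using hr
  have h0 : c = 0 := by
    have := LinearMap.congr_fun (h (𝔪.liftQ _ hle')) (Submodule.Quotient.mk 1)
    rw [Submodule.liftQ_apply] at this
    simpa using this
  apply hP.isPrime.ne_top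
  rw [Ideal.eq_top_iff_one, hc, h0]
  simp [Submodule.mem_colon_singleton]

/-- Rees' induction: if `Ext^n(k, U) ≠ 0` for a residue field `k` and `Ext^{n+1}(-, U) = 0`, then
`Ext^j(k, C) = 0` for `j < s` whenever `Ext^i(C, U) = 0` for all `i > n - s`. -/
lemma subsingleton_ext_residue (U : ModuleCat.{u} A) {𝔪 : Ideal A} (h𝔪 : 𝔪.IsMaximal) {n : ℕ}
    (hn : Nontrivial (Abelian.Ext.{u} (ModuleCat.of A (A ⧸ 𝔪)) U n))
    (hU : HasInjectiveDimensionLT U (n + 1)) (s : ℕ) (hs : s ≤ n) :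
    ∀ (C : Type u) [AddCommGroup C] [Module A C] [Module.Finite A C],
      (∀ i, n < i + s → Subsingleton (Abelian.Ext.{u} (ModuleCat.of A C) U i)) →
      ∀ j, j < s →
        Subsingleton (Abelian.Ext.{u} (ModuleCat.of A (A ⧸ 𝔪)) (ModuleCat.of A C) j) := by
  induction s with
  | zero => exact fun _ _ _ _ _ j hj ↦ absurd hj (Nat.not_lt_zero j)
  | succ s ih =>
    intro C _ _ _ hC j hj
    -- A non-zero `f` is injective, and `Ext^{n+1}(-, U) = 0` makes `Ext^n(C, U) → Ext^n(A/𝔪, U)`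
    -- surjective; its source is zero and its target is not.
    have h0 (f : (A ⧸ 𝔪) →ₗ[A] C) : f = 0 := by
      by_contra hf
      refine not_subsingleton_iff_nontrivial.2 hn ?_
      exact subsingleton_ext_of_exact_left (injective_of_quotient_maximal h𝔪 f hf)
        (LinearMap.exact_map_mkQ_range _) (Submodule.mkQ_surjective _) n (hC n (by lia))
        (HasInjectiveDimensionLT.subsingleton _ (n + 1) (n + 1) le_rfl _)
    obtain ⟨x, hx, hreg⟩ := exists_regular_of_hom_eq_zero h𝔪 C h0
    have hS := shortExact_exactComplex hreg (LinearMap.exact_map_mkQ_range _)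
      (Submodule.mkQ_surjective _)
    cases j with
    | zero =>
      refine subsingleton_of_forall_eq 0 fun e ↦ ?_
      obtain ⟨f, rfl⟩ := (Abelian.Ext.mk₀_bijective _ _).surjective e
      have : f = 0 := ModuleCat.hom_ext (h0 f.hom)
      rw [this, Abelian.Ext.mk₀_zero]
    | succ j =>
      have h1 := ih (by lia) (C ⧸ LinearMap.range (LinearMap.lsmul A C x)) (fun i hi ↦ by
        obtain ⟨i, rfl⟩ := Nat.exists_eq_succ_of_ne_zero (show i ≠ 0 by lia)
        exact subsingleton_ext_of_exact_right hreg (LinearMap.exact_map_mkQ_range _)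
          (Submodule.mkQ_surjective _) i (hC i (by lia)) (hC (i + 1) (by lia))) j (by lia)
      refine subsingleton_of_forall_eq 0 fun e ↦ ?_
      -- `x` kills `A/𝔪`, hence `Ext(A/𝔪, C)`, so every class comes from `Ext^j(A/𝔪, C/xC)`, zero by
      -- induction.
      have he : e.comp (Abelian.Ext.mk₀ (ModuleCat.ofHom (LinearMap.lsmul A C x)))
          (add_zero (j + 1)) = 0 := by
        have h2 : ModuleCat.ofHom (LinearMap.lsmul A C x) = x • 𝟙 (ModuleCat.of A C) := rfl
        rw [h2, ← Abelian.Ext.smul_eq_comp_mk₀, ← smul_eq_mk₀_comp]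
        have h3 : LinearMap.lsmul A (A ⧸ 𝔪) x = 0 := by
          ext
          change (Submodule.Quotient.mk (x • 1) : A ⧸ 𝔪) = 0
          rw [Submodule.Quotient.mk_eq_zero]
          exact Ideal.mul_mem_right _ _ hx
        rw [h3, ModuleCat.ofHom_zero, Abelian.Ext.mk₀_zero, Abelian.Ext.zero_comp]
      obtain ⟨y, rfl⟩ := Abelian.Ext.covariant_sequence_exact₁ _ hS e he rfl
      rw [Subsingleton.elim y 0, Abelian.Ext.zero_comp]

/-- Submodules `X` of `Ext^n(N, U)`, for `U` projective of injective dimension at most `n`, satisfy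
`Ext^j(X, U) = 0` for `j < n`. -/
lemma subsingleton_ext_of_injective_top (U : ModuleCat.{u} A) [Module.Finite A U]
    (hP : ∀ i, Subsingleton (Abelian.Ext.{u} U U (i + 1))) {n : ℕ}
    (hU : HasInjectiveDimensionLT U (n + 1)) (N : ModuleCat.{u} A) [hN : Module.Finite A N]
    (X : Type u) [AddCommGroup X] [Module A X] [hX : Module.Finite A X]
    (φ : X →ₗ[A] Abelian.Ext.{u} N U n) (hφ : Function.Injective φ) (j : ℕ) (hj : j < n) :
    Subsingleton (Abelian.Ext.{u} (ModuleCat.of A X) U j) := by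
  have htop (p : PrimeSpectrum A) (M : Type u) [AddCommGroup M] [Module A M] :
      p ∉ Module.support A (Abelian.Ext.{u} (ModuleCat.of A M) U (n + 1)) := by
    have := HasInjectiveDimensionLT.subsingleton U (n + 1) (n + 1) le_rfl (ModuleCat.of A M)
    rw [Module.support_eq_empty]
    exact Set.notMem_empty _
  have key (p : PrimeSpectrum A) (hp : p ∈ Module.support A X) :
      Subsingleton (Abelian.Ext.{u} (ModuleCat.of A (A ⧸ p.asIdeal)) U j) := by
    have h₁ : p ∈ Module.support A (Abelian.Ext.{u} (ModuleCat.of A (A ⧸ p.asIdeal)) U n) := by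
      by_contra h
      exact notMem_support_ext U p n (fun M ↦ htop p M) h N
        (Module.support_subset_of_injective φ hφ hp)
    obtain ⟨𝔪, h𝔪, hle⟩ := p.asIdeal.exists_le_maximal p.2.ne_top
    let q : PrimeSpectrum A := ⟨𝔪, h𝔪.isPrime⟩
    have hq : q ∈ Module.support A (Abelian.Ext.{u} (ModuleCat.of A (A ⧸ p.asIdeal)) U n) :=
      Module.mem_support_mono hle h₁
    -- Otherwise some `x ∈ 𝔪 \ p` is regular on `A/p`; since `Ext^{n+1}(-, U) = 0`, Nakayama would
    -- make `Ext^n(A/p, U)` vanish at `𝔪`.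
    have hmax : p.asIdeal.IsMaximal := by
      by_cases hge : 𝔪 ≤ p.asIdeal
      · rwa [le_antisymm hle hge]
      · obtain ⟨x, hx, hxp⟩ := SetLike.not_le_iff_exists.1 hge
        exact absurd hq (notMem_support_ext_of_regular U (p := q) hx
          (lsmul_injective_of_equiv_quotient p (LinearEquiv.refl _ _) hxp) n (htop q _))
    exact subsingleton_ext_residue U hmax (Module.nonempty_support_iff.1 ⟨p, h₁⟩) hU n le_rfl U
      (fun i hi ↦ by
        obtain ⟨i, rfl⟩ := Nat.exists_eq_succ_of_ne_zero (show i ≠ 0 by lia)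
        exact hP i) j hj
  -- Only the condition on supports passes to the quotients in a prime filtration; an embedding into
  -- `Ext^n(N, U)` need not.
  clear hφ
  clear φ
  induction hX using IsNoetherianRing.induction_on_isQuotientEquivQuotientPrime A with
  | subsingleton X =>
    refine subsingleton_of_forall_eq 0 fun x ↦ ?_
    rw [← one_smul A x, ← smul_eq_mk₀_comp U 1 x, Subsingleton.elim (LinearMap.lsmul A X 1) 0,
      ModuleCat.ofHom_zero, Abelian.Ext.mk₀_zero, Abelian.Ext.zero_comp]
  | quotient X q e => exact subsingleton_ext_congr e.symm (key q (mem_support_of_equiv_quotient q e))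
  | exact X₁ X₂ X₃ f g hf hg hfg h₁ h₃ =>
    exact subsingleton_ext_of_exact_middle hf hfg hg j
      (h₁ fun p hp ↦ key p (Module.support_subset_of_injective f hf hp))
      (h₃ fun p hp ↦ key p (Module.support_subset_of_surjective g hg hp))

/-- Submodules `X` of `Ext^1(N, U)`, for `U` projective of finite injective dimension, satisfy
`Hom(X, U) = 0`. -/
lemma subsingleton_ext_of_injective_one (U : ModuleCat.{u} A) [Module.Finite A U]
    (hP : ∀ i, Subsingleton (Abelian.Ext.{u} U U (i + 1))) {m : ℕ}
    (hU : HasInjectiveDimensionLT U m) (N : ModuleCat.{u} A) [hN : Module.Finite A N]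
    (X : Type u) [AddCommGroup X] [Module A X]
    (φ : X →ₗ[A] Abelian.Ext.{u} N U 1) (hφ : Function.Injective φ) :
    Subsingleton (Abelian.Ext.{u} (ModuleCat.of A X) U 0) := by
  refine subsingleton_of_forall_eq 0 fun e ↦ ?_
  obtain ⟨f, rfl⟩ := (Abelian.Ext.mk₀_bijective _ _).surjective e
  suffices f = 0 by rw [this, Abelian.Ext.mk₀_zero]
  ext x
  by_contra hx
  -- The annihilator of `f x` lies in an associated prime `P` of `U`, at which `Ext^1(N, U)` and so
  -- `X` vanish. Then some `r ∉ P` kills `x`, hence `f x`, a contradiction.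
  obtain ⟨P, hP', hle⟩ := exists_le_isAssociatedPrime_of_isNoetherianRing A (f.hom x) hx
  let p : PrimeSpectrum A := ⟨P, hP'.isPrime⟩
  obtain ⟨-, c, hc⟩ := (isAssociatedPrime_iff (R := A)).1 hP'
  have hker : P = LinearMap.ker (LinearMap.toSpanSingleton A U c) := by
    rw [hc]
    ext r
    rw [Submodule.mem_colon_singleton, Submodule.mem_bot, LinearMap.mem_ker,
      LinearMap.toSpanSingleton_apply]
  have hp := notMem_support_ext_of_embedding U hU hP p
    (P.liftQ (LinearMap.toSpanSingleton A U c) hker.le)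
    (LinearMap.ker_eq_bot.1 (Submodule.ker_liftQ_eq_bot' _ _ hker)) m 0 (by lia) N
  have hp' : p ∉ Module.support A X := fun h ↦ hp (Module.support_subset_of_injective φ hφ h)
  rw [Module.notMem_support_iff'] at hp'
  obtain ⟨r, hr, hrx⟩ := hp' x
  refine hr (hle ?_)
  rw [Submodule.mem_colon_singleton, Submodule.mem_bot, ← map_smul, hrx, map_zero]

end CommutativeGrade

/-! ### Passage between a commutative ring and its opposite -/

section Transport

attribute [local instance] RingHomInvPair.of_ringEquiv

variable {R : Type u} [CommRing R]

/-- For a commutative ring, vanishing of `Ext^j(X, R)` can be tested over the opposite ring. -/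
lemma subsingleton_ext_of_restrictScalars (X : ModuleCat.{u} R) (j : ℕ)
    (h : Subsingleton (Abelian.Ext.{u}
      ((ModuleCat.restrictScalars (RingEquiv.toOpposite R).symm.toRingHom).obj X)
      (ModuleCat.of Rᵐᵒᵖ R) j)) :
    Subsingleton (Abelian.Ext.{u} X (ModuleCat.of R R) j) := by
  let G : ModuleCat.{u} R ⥤ ModuleCat.{u} Rᵐᵒᵖ :=
    ModuleCat.restrictScalars (RingEquiv.toOpposite R).symm.toRingHom
  let l : G.obj (ModuleCat.of R R) ≃ₗ[Rᵐᵒᵖ] ModuleCat.of Rᵐᵒᵖ R :=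
    { AddEquiv.refl R with
      map_smul' r x := mul_comm (MulOpposite.unop r) x }
  let e : G.obj (ModuleCat.of R R) ≅ ModuleCat.of Rᵐᵒᵖ R := l.toModuleIso
  have hG : Function.Injective (G.mapExtAddHom X (ModuleCat.of R R) j) :=
    (G.mapExt_bijective_of_preservesProjectiveObjects X (ModuleCat.of R R) j).injective
  have : Subsingleton (Abelian.Ext.{u} (G.obj X) (G.obj (ModuleCat.of R R)) j) := by
    refine subsingleton_of_forall_eq 0 fun x ↦ ?_
    have h1 : (x.comp (Abelian.Ext.mk₀ e.hom) (add_zero j)).comp (Abelian.Ext.mk₀ e.inv)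
        (add_zero j) = x := by
      rw [Abelian.Ext.comp_assoc_of_third_deg_zero, Abelian.Ext.mk₀_comp_mk₀, e.hom_inv_id,
        Abelian.Ext.comp_mk₀_id]
    have h2 : x.comp (Abelian.Ext.mk₀ e.hom) (add_zero j) = 0 := h.elim _ _
    rw [← h1, h2, Abelian.Ext.zero_comp]
  exact hG.subsingleton

lemma hasInjectiveDimensionLT_op {n : ℕ} (h : HasInjectiveDimensionLT (ModuleCat.of R R) (n + 1)) :
    HasInjectiveDimensionLT (ModuleCat.of Rᵐᵒᵖ R) (n + 1) :=
  (ModuleCat.hasInjectiveDimensionLE_iff_of_semiLinearEquiv (RingEquiv.toOpposite R)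
    (M := ModuleCat.of R R) (N := ModuleCat.of Rᵐᵒᵖ R)
    { AddEquiv.refl R with
      map_smul' r x := mul_comm r x } n).1 h

/-- Both scalars act by functoriality in the second variable, and by commutativity left and right
multiplication by `r` on `R` are the same map. -/
lemma BimoduleExt.op_smul_eq {N : ModuleCat.{u} Rᵐᵒᵖ} {n : ℕ} (r : R)
    (x : Abelian.Ext.{u} N (ModuleCat.of Rᵐᵒᵖ R) n) :
    MulOpposite.op r • x = (show Abelian.Ext.{u} N (ModuleCat.of Rᵐᵒᵖ R) n from
      (r • (show BimoduleExt R R N n from x) : BimoduleExt R R N n)) := by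
  rw [Abelian.Ext.smul_eq_comp_mk₀]
  have : MulOpposite.op r • 𝟙 (ModuleCat.of Rᵐᵒᵖ R) = leftMul (S := R) R r := by
    refine ModuleCat.hom_ext (LinearMap.ext fun y ↦ ?_)
    exact mul_comm y r
  rw [this]
  rfl

/-- Submodules of modules in `𝓔_n` over a commutative ring embed, as modules over the opposite
ring, into an `Ext`-module over the opposite ring. -/
lemma exists_embedding_of_extClass {n : ℕ} {M : ModuleCat.{u} R} (hM : extClass R R R n M)
    (X : Submodule R M) :
    ∃ N : ModuleCat.{u} Rᵐᵒᵖ, Module.Finite Rᵐᵒᵖ N ∧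
      ∃ φ : (ModuleCat.restrictScalars (RingEquiv.toOpposite R).symm.toRingHom).obj
          (ModuleCat.of R X) →ₗ[Rᵐᵒᵖ] Abelian.Ext.{u} N (ModuleCat.of Rᵐᵒᵖ R) n,
        Function.Injective φ := by
  obtain ⟨-, N, hN, ⟨e⟩⟩ := hM
  refine ⟨N, hN,
    { toFun x := e (X.subtype x)
      map_add' x y := (congrArg e (map_add X.subtype x y)).trans (map_add e _ _)
      map_smul' r x := ?_ }, e.injective.comp X.injective_subtype⟩
  refine Eq.trans ?_ (BimoduleExt.op_smul_eq (MulOpposite.unop r) _).symm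
  exact map_smul e (MulOpposite.unop r) (X.subtype x)

/-- Over a commutative noetherian ring with `Ext^j(X, R) = 0` for `j < n` whenever `X` embeds in some
`Ext^n(N, R)`, the class `𝓔_n` is submodule-closed. -/
lemma isSubmoduleClosed_extClass_of_commRing [IsNoetherianRing R] (n : ℕ)
    (h : ∀ (N : ModuleCat.{u} Rᵐᵒᵖ) [Module.Finite Rᵐᵒᵖ N] (X : Type u) [AddCommGroup X]
      [Module Rᵐᵒᵖ X] [Module.Finite Rᵐᵒᵖ X]
      (φ : X →ₗ[Rᵐᵒᵖ] Abelian.Ext.{u} N (ModuleCat.of Rᵐᵒᵖ R) (n + 1)), Function.Injective φ →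
      ∀ j, j < n + 1 →
        Subsingleton (Abelian.Ext.{u} (ModuleCat.of Rᵐᵒᵖ X) (ModuleCat.of Rᵐᵒᵖ R) j)) :
    IsSubmoduleClosed (extClass R R R (n + 1)) := by
  refine isSubmoduleClosed_extClass n fun M hM X j hj ↦ ?_
  obtain ⟨N, hN, φ, hφ⟩ := exists_embedding_of_extClass hM X
  have : Module.Finite Rᵐᵒᵖ ((ModuleCat.restrictScalars
      (RingEquiv.toOpposite R).symm.toRingHom).obj (ModuleCat.of R X)) := by
    have := hM.1
    have hX : Module.Finite R X := inferInstance
    obtain ⟨s, hs⟩ := hX.fg_top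
    refine ⟨s, eq_top_iff.2 fun x _ ↦ ?_⟩
    have hx : ∀ y : X, y ∈ Submodule.span R (s : Set X) := fun y ↦ hs ▸ Submodule.mem_top
    induction hx x using Submodule.span_induction with
    | mem x hx => exact Submodule.subset_span hx
    | zero => exact zero_mem _
    | add x y _ _ hx hy => exact add_mem (hx trivial) (hy trivial)
    | smul r x _ hx => exact Submodule.smul_mem _ (MulOpposite.op r) (hx trivial)
  exact subsingleton_ext_of_restrictScalars _ j (h N _ φ hφ j hj)

end Transport

/-! ### Degree zero and the main theorem -/

section Main

variable {R : Type u}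

lemma IsIwanagaGorenstein.isSubmoduleClosed_zero [Ring R] (hR : IsIwanagaGorenstein R)
    (h : leftSelfInjDim R = (0 : ℕ)) : IsSubmoduleClosed (extClass R R R 0) := by
  have := hR.left_noetherian
  have := hR.right_noetherian
  have h₁ : HasInjectiveDimensionLT (ModuleCat.of R R) 1 :=
    (injectiveDimension_le_iff _ 0).1 h.le
  obtain ⟨m, hm⟩ := (injectiveDimension_ne_top_iff _).1 hR.right_finite.ne
  intro M hM X _
  have := hM.1
  have : Module.Finite R (ModuleCat.of R X) := inferInstanceAs (Module.Finite R X)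
  exact extClass_zero_of_injective h₁ hm _

end Main

end AuslanderGorenstein
open AuslanderGorenstein in
theorem corollary3p9 :
    (∀ (R : Type u) [Ring R], IsAuslanderGorenstein R →
      (∀ n : ℕ, leftSelfInjDim R = n → IsSubmoduleClosed (extClass R R R n)) ∧
      IsSubmoduleClosed (extClass R R R 1)) ∧
    (∀ (R : Type u) [CommRing R], IsIwanagaGorenstein R →
      (∀ n : ℕ, leftSelfInjDim R = n → IsSubmoduleClosed (extClass R R R n)) ∧
      IsSubmoduleClosed (extClass R R R 1)) := by
  refine ⟨fun R _ hR ↦ ?_, fun R _ hR ↦ ?_⟩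
  · have := hR.left_noetherian
    have := hR.right_noetherian
    -- The Auslander condition handles all positive degrees at once; self-injective dimension zero
    -- is the one remaining case.
    have key (n : ℕ) : IsSubmoduleClosed (extClass R R R (n + 1)) :=
      isSubmoduleClosed_extClass n (hR.auslander.subsingleton_ext n)
    refine ⟨fun n hn ↦ ?_, key 0⟩
    cases n with
    | zero => exact hR.toIsIwanagaGorenstein.isSubmoduleClosed_zero hn
    | succ n => exact key n
  · have := hR.left_noetherian
    have := hR.right_noetherian
    have : Module.Finite Rᵐᵒᵖ (ModuleCat.of Rᵐᵒᵖ R) := Module.Finite.equiv (opRegularEquiv R)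
    have hP (i : ℕ) : Subsingleton (Abelian.Ext.{u} (ModuleCat.of Rᵐᵒᵖ R) (ModuleCat.of Rᵐᵒᵖ R)
        (i + 1)) := by
      have : Module.Projective Rᵐᵒᵖ R := Module.Projective.of_equiv (opRegularEquiv R)
      exact Abelian.Ext.subsingleton_of_projective (P := ModuleCat.of Rᵐᵒᵖ R) _ _
    obtain ⟨m, hm⟩ := (injectiveDimension_ne_top_iff _).1 hR.right_finite.ne
    refine ⟨fun n hn ↦ ?_, ?_⟩
    · cases n with
      | zero => exact hR.isSubmoduleClosed_zero hn
      | succ n =>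
        exact isSubmoduleClosed_extClass_of_commRing n fun N _ X _ _ _ φ hφ j hj ↦
          subsingleton_ext_of_injective_top _ hP
            (hasInjectiveDimensionLT_op ((injectiveDimension_le_iff _ (n + 1)).1 hn.le)) N X φ hφ j hj
    · refine isSubmoduleClosed_extClass_of_commRing 0 fun N _ X _ _ _ φ hφ j hj ↦ ?_
      obtain rfl : j = 0 := by lia
      exact subsingleton_ext_of_injective_one _ hP hm N X φ hφ
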